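/- All Hilbert spaces are finite-dimensional, logarithms are to base $2$, $\|X\|_1=\mathrm{Tr}\sqrt{X^\dagger X}$, and superscripts denote reduced states. A \emph{quantum operation} is a linear completely positive trace-preserving map. For a tripartite state $\rho^{ABC}$ let $S(\rho)=-\mathrm{Tr}\,\rho\log\rho$ and $$I(A:C|B)_\rho=S(\rho^{AB})+S(\rho^{BC})-S(\rho^{B})-S(\rho^{ABC}).$$ For $\epsilon>0$, a tripartite state $\rho^{ABC}$ is called - \emph{$\epsilon$-recoverable from $BC$} if $\|\rho^{ABC}-(\mathcal R\otimes\mathrm{id}_C)(\rho^{BC})\|_1\le\epsilon$ for some quantum operation $\mathcal R:B\to AB$; - \emph{$\epsilon$-recoverable from $AB$} if $\|\rho^{ABC}-(\mathrm{id}_A\otimes\mathcal R')(\rho^{AB})\|_1\le\epsilon$ for some quantum operation $\mathcal R':B\to BC$; - \emph{$\epsilon$-decomposable on $B$} if $\|\rho^{ABC}-\Upsilon^{ABC}\|_1\le\epsilon$ for some Markov state $\Upsilon^{ABC}$ conditioned by $B$, that is, a state for which there are an isometry $\Gamma:\mathcal H^B\to\mathcal H^{b_0}\otimes\mathcal H^{b_L}\otimes\mathcal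 H^{b_R}$, a probability distribution $\{q_i\}$, an orthonormal basis $\{|i\rangle\}$ of $\mathcal H^{b_0}$, and states $\sigma_i$ on $\mathcal H^A\otimes\mathcal H^{b_L}$ and $\phi_i$ on $\mathcal H^{b_R}\otimes\mathcal H^C$ with $\Gamma\Upsilon^{ABC}\Gamma^\dagger=\sum_i q_i|i\rangle\langle i|^{b_0}\otimes\sigma_i^{Ab_L}\otimes\phi_i^{b_RC}$. Let $R\in\mathbb R$ and $K_n=\lfloor 2^{nR}\rfloor$. We say that $\rho^{ABC}$ is Markovianized with randomness cost $R$ on $A$ in terms of decomposability (respectively, in terms of recoverability from $BC$, in terms of recoverability from $AB$) if for every $\epsilon>0$ there is $n_\epsilon$ such that for every $n\ge n_\epsilon$ we have $K_n\ge1$ and there are unitaries $V_1,\dots,V_{K_n}$ on $(\mathcal H^A)^{\otimes n}$ such that, with $\mathcal V_n(\tau)=K_n^{-1}\sum_{k=1}^{K_n}V_k\tau V_k^\dagger$ acting on $A^n$, the state $\mathcal V_n((\rho^{ABC})^{\otimes n})$ on $A^nB^nC^n$ is $\epsilon$-decomposable on $B^n$ (respectively, $\epsilon$-recoverable from $B^nC^n$,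 $\epsilon$-recoverable from $A^nB^n$). The costs $M^D_{A|B}(\rho)$, $M^R_{A|BC}(\rho)$ and $M^R_{A|AB}(\rho)$ are the infima, in $[-\infty,\infty]$, of the sets of such $R$ in the three respective senses. \textbf{Theorem.} For every (possibly mixed) tripartite state $\rho^{ABC}$, $$I(A:C|B)_\rho\le M^R_{A|BC}(\rho^{ABC})\le M^D_{A|B}(\rho^{ABC})$$ and $$I(A:C|B)_\rho\le M^R_{A|AB}(\rho^{ABC})\le M^D_{A|B}(\rho^{ABC}).$$ -/

import Mathlib

open scoped Kronecker ComplexOrder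

noncomputable section

namespace Markovianization

/-! Finite-dimensional systems are finite index types: the Hilbert space of a system with index
type `m` is `ℂ^m` with its standard orthonormal basis, operators on it are `Matrix m m ℂ`, and the
system composed of `m` and `m'` has index type `m × m'`. -/

section Basic

variable {m m' : Type*} [Fintype m] [DecidableEq m] [Fintype m']

/-- Density operators. -/
def IsState (ρ : Matrix m m ℂ) : Prop := ρ.PosSemidef ∧ ρ.trace = 1

/-- The trace norm `‖X‖₁ = Tr √(Xᴴ X)`, i.e. the sum of the singular values of `X`. -/
def traceNorm (X : Matrix m m ℂ) : ℝ :=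
  ∑ i, √((Matrix.isHermitian_conjTranspose_mul_self X).eigenvalues i)

/-- The von Neumann entropy `S(ρ) = -Tr ρ log₂ ρ` (in bits), computed from the eigenvalues. The
value `0` for matrices that are not Hermitian is never used. -/
def entropy (ρ : Matrix m m ℂ) : ℝ :=
  if h : ρ.IsHermitian then ∑ i, Real.negMulLog (h.eigenvalues i) / Real.log 2 else 0

/-- Partial trace over the first factor. -/
def traceFst (X : Matrix (m × m') (m × m') ℂ) : Matrix m' m' ℂ :=
  fun j j' => ∑ i, X (i, j) (i, j')

/-- Partial trace over the second factor. -/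
def traceSnd (X : Matrix (m × m') (m × m') ℂ) : Matrix m m ℂ :=
  fun i i' => ∑ j, X (i, j) (i', j)

end Basic

section Channels

variable {m n : Type*}

/-- The map `id_k ⊗ Φ`: it applies `Φ` to every block of a block matrix. -/
def idTensor (k : Type*) (Φ : Matrix m m ℂ →ₗ[ℂ] Matrix n n ℂ)
    (X : Matrix (k × m) (k × m) ℂ) : Matrix (k × n) (k × n) ℂ :=
  fun p q => Φ (fun i j => X (p.1, i) (q.1, j)) p.2 q.2

/-- The map `Φ ⊗ id_k`. -/
def tensorId (k : Type*) (Φ : Matrix m m ℂ →ₗ[ℂ] Matrix n n ℂ)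
    (X : Matrix (m × k) (m × k) ℂ) : Matrix (n × k) (n × k) ℂ :=
  fun p q => Φ (fun i j => X (i, p.2) (j, q.2)) p.1 q.1

/-- Quantum operations: linear completely positive trace-preserving maps. -/
structure IsQuantumOperation [Fintype m] [Fintype n]
    (Φ : Matrix m m ℂ →ₗ[ℂ] Matrix n n ℂ) : Prop where
  completelyPositive : ∀ (d : ℕ) (X : Matrix (Fin d × m) (Fin d × m) ℂ),
    X.PosSemidef → (idTensor (Fin d) Φ X).PosSemidef
  tracePreserving : ∀ X : Matrix m m ℂ, (Φ X).trace = X.trace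

end Channels

/-! Tripartite systems `ABC` have index type `A × B × C`, that is `A × (B × C)`. -/

section Tripartite

variable {A B C : Type*} [Fintype A] [Fintype B] [Fintype C]

/-- The reduced operator on `BC`. -/
def marginalBC (X : Matrix (A × B × C) (A × B × C) ℂ) : Matrix (B × C) (B × C) ℂ := traceFst X

/-- The reduced operator on `AB`. -/
def marginalAB (X : Matrix (A × B × C) (A × B × C) ℂ) : Matrix (A × B) (A × B) ℂ :=
  traceSnd (X.submatrix (Equiv.prodAssoc A B C) (Equiv.prodAssoc A B C))

/-- The reduced operator on `B`. -/
def marginalB (X : Matrix (A × B × C) (A × B × C) ℂ) : Matrix B B ℂ := traceFst (marginalAB X)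

variable [DecidableEq A] [DecidableEq B] [DecidableEq C]

/-- The quantum conditional mutual information
`I(A:C|B) = S(AB) + S(BC) - S(B) - S(ABC)`, in bits. -/
def condMutualInfo (ρ : Matrix (A × B × C) (A × B × C) ℂ) : ℝ :=
  entropy (marginalAB ρ) + entropy (marginalBC ρ) - entropy (marginalB ρ) - entropy ρ

/-- Recoverability from `BC` up to `ε`: some quantum operation `Φ : B → AB` satisfies
`‖X^{ABC} - (Φ ⊗ id_C)(X^{BC})‖₁ ≤ ε`. -/
def RecoverableFromBC (ε : ℝ) (X : Matrix (A × B × C) (A × B × C) ℂ) : Prop :=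
  ∃ Φ : Matrix B B ℂ →ₗ[ℂ] Matrix (A × B) (A × B) ℂ, IsQuantumOperation Φ ∧
    traceNorm (X - (tensorId C Φ (marginalBC X)).submatrix
      (Equiv.prodAssoc A B C).symm (Equiv.prodAssoc A B C).symm) ≤ ε

/-- Recoverability from `AB` up to `ε`: some quantum operation `Φ : B → BC` satisfies
`‖X^{ABC} - (id_A ⊗ Φ)(X^{AB})‖₁ ≤ ε`. -/
def RecoverableFromAB (ε : ℝ) (X : Matrix (A × B × C) (A × B × C) ℂ) : Prop :=
  ∃ Φ : Matrix B B ℂ →ₗ[ℂ] Matrix (B × C) (B × C) ℂ, IsQuantumOperation Φ ∧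
    traceNorm (X - idTensor A Φ (marginalAB X)) ≤ ε

/-- The operator `∑ᵢ qᵢ |i⟩⟨i| ⊗ σᵢ ⊗ φᵢ` on `A (b₀ b_L b_R) C`, where `|i⟩⟨i|` acts on `b₀`,
`σᵢ` on `A b_L` and `φᵢ` on `b_R C`. -/
def markovForm {b₀ bL bR : Type*} [DecidableEq b₀] (q : b₀ → ℝ)
    (σ : b₀ → Matrix (A × bL) (A × bL) ℂ) (φ : b₀ → Matrix (bR × C) (bR × C) ℂ) :
    Matrix (A × (b₀ × bL × bR) × C) (A × (b₀ × bL × bR) × C) ℂ :=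
  fun x y => match x, y with
    | (a, (i, l, r), c), (a', (i', l', r'), c') =>
      if i = i' then (q i : ℂ) * σ i (a, l) (a', l') * φ i (r, c) (r', c') else 0

/-- Markov states conditioned by `B`: states `Υ` on `ABC` that have a Markov decomposition
`(1_A ⊗ Γ ⊗ 1_C) Υ (1_A ⊗ Γ ⊗ 1_C)† = ∑ᵢ qᵢ |i⟩⟨i| ⊗ σᵢ ⊗ φᵢ`, where `Γ : B → b₀ b_L b_R` is an
isometry into a tensor product of three finite-dimensional Hilbert spaces, `q` is a probability
distribution, and `σᵢ` on `A b_L` and `φᵢ` on `b_R C` are states. -/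
def IsMarkovState (Υ : Matrix (A × B × C) (A × B × C) ℂ) : Prop :=
  IsState Υ ∧
  ∃ (d₀ dL dR : ℕ) (Γ : Matrix (Fin d₀ × Fin dL × Fin dR) B ℂ) (q : Fin d₀ → ℝ)
    (σ : Fin d₀ → Matrix (A × Fin dL) (A × Fin dL) ℂ)
    (φ : Fin d₀ → Matrix (Fin dR × C) (Fin dR × C) ℂ),
    Γ.conjTranspose * Γ = 1 ∧
    (∀ i, 0 ≤ q i) ∧ ∑ i, q i = 1 ∧
    (∀ i, IsState (σ i)) ∧ (∀ i, IsState (φ i)) ∧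
    ((1 : Matrix A A ℂ) ⊗ₖ (Γ ⊗ₖ (1 : Matrix C C ℂ))) * Υ *
      ((1 : Matrix A A ℂ) ⊗ₖ (Γ ⊗ₖ (1 : Matrix C C ℂ))).conjTranspose = markovForm q σ φ

/-- Decomposability on `B` up to `ε`: some Markov state conditioned by `B` is `ε`-close in trace
norm. -/
def Decomposable (ε : ℝ) (X : Matrix (A × B × C) (A × B × C) ℂ) : Prop :=
  ∃ Υ : Matrix (A × B × C) (A × B × C) ℂ, IsMarkovState Υ ∧ traceNorm (X - Υ) ≤ ε

/-- The random unitary operation `τ ↦ K⁻¹ ∑ₖ (Vₖ ⊗ 1) τ (Vₖ ⊗ 1)†` on `A`, for a list of `K`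
unitaries, applied to an operator on `ABC`. -/
def randomUnitary {K : ℕ} (V : Fin K → Matrix.unitaryGroup A ℂ)
    (X : Matrix (A × B × C) (A × B × C) ℂ) : Matrix (A × B × C) (A × B × C) ℂ :=
  (K : ℂ)⁻¹ • ∑ k, ((V k : Matrix A A ℂ) ⊗ₖ (1 : Matrix (B × C) (B × C) ℂ)) * X *
    ((V k : Matrix A A ℂ) ⊗ₖ (1 : Matrix (B × C) (B × C) ℂ)).conjTranspose

end Tripartite

section Costs

variable {A B C : Type*} [Fintype A] [Fintype B] [Fintype C]
  [DecidableEq A] [DecidableEq B] [DecidableEq C]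

/-- The `n`-fold tensor power `ρ^{⊗n}` of an operator on `ABC`, as an operator on `Aⁿ Bⁿ Cⁿ`. -/
def tensorPower (ρ : Matrix (A × B × C) (A × B × C) ℂ) (n : ℕ) :
    Matrix ((Fin n → A) × (Fin n → B) × (Fin n → C))
      ((Fin n → A) × (Fin n → B) × (Fin n → C)) ℂ :=
  fun x y => ∏ j, ρ (x.1 j, x.2.1 j, x.2.2 j) (y.1 j, y.2.1 j, y.2.2 j)

/-- The number `⌊2^{nR}⌋` of unitaries that randomness cost `R` allows on `n` copies. -/
def numUnitaries (n : ℕ) (R : ℝ) : ℕ := ⌊(2 : ℝ) ^ ((n : ℝ) * R)⌋₊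

/-- `ρ` is Markovianized with the randomness cost `R` on `A`, conditioned by `B` (in terms of
decomposability). -/
def MarkovianizedDec (ρ : Matrix (A × B × C) (A × B × C) ℂ) (R : ℝ) : Prop :=
  ∀ ε : ℝ, 0 < ε → ∃ N : ℕ, ∀ n : ℕ, N ≤ n → 0 < numUnitaries n R ∧
    ∃ V : Fin (numUnitaries n R) → Matrix.unitaryGroup (Fin n → A) ℂ,
      Decomposable ε (randomUnitary V (tensorPower ρ n))

/-- `ρ` is Markovianized with the randomness cost `R` on `A`, in terms of recoverability from
`BC`. -/
def MarkovianizedRecBC (ρ : Matrix (A × B × C) (A × B × C) ℂ) (R : ℝ) : Prop :=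
  ∀ ε : ℝ, 0 < ε → ∃ N : ℕ, ∀ n : ℕ, N ≤ n → 0 < numUnitaries n R ∧
    ∃ V : Fin (numUnitaries n R) → Matrix.unitaryGroup (Fin n → A) ℂ,
      RecoverableFromBC ε (randomUnitary V (tensorPower ρ n))

/-- `ρ` is Markovianized with the randomness cost `R` on `A`, in terms of recoverability from
`AB`. -/
def MarkovianizedRecAB (ρ : Matrix (A × B × C) (A × B × C) ℂ) (R : ℝ) : Prop :=
  ∀ ε : ℝ, 0 < ε → ∃ N : ℕ, ∀ n : ℕ, N ≤ n → 0 < numUnitaries n R ∧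
    ∃ V : Fin (numUnitaries n R) → Matrix.unitaryGroup (Fin n → A) ℂ,
      RecoverableFromAB ε (randomUnitary V (tensorPower ρ n))

/-- The M-Dec cost `M^D_{A|B}(ρ)`. Infima of sets of reals are taken in `[-∞, ∞]`. -/
def costDec (ρ : Matrix (A × B × C) (A × B × C) ℂ) : EReal :=
  sInf ((fun R : ℝ => (R : EReal)) '' {R | MarkovianizedDec ρ R})

/-- The M-Rec cost `M^R_{A|BC}(ρ)`. -/
def costRecBC (ρ : Matrix (A × B × C) (A × B × C) ℂ) : EReal :=
  sInf ((fun R : ℝ => (R : EReal)) '' {R | MarkovianizedRecBC ρ R})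

/-- The M-Rec cost `M^R_{A|AB}(ρ)`. -/
def costRecAB (ρ : Matrix (A × B × C) (A × B × C) ℂ) : EReal :=
  sInf ((fun R : ℝ => (R : EReal)) '' {R | MarkovianizedRecAB ρ R})

end Costs

end Markovianization

end

/-!
The inequalities between the costs hold because a Markov state is recovered exactly from each of its
two marginals (`IsMarkovState.recoverable`): after the isometry `Γ`, dephase `b₀`, replace `b_L` by a
fresh copy of `A b_L` in the state `σᵢ` (respectively `b_R` by a copy of `b_R C` in the state `φᵢ`),
and undo `Γ`. A positive trace-preserving map with fixed point `Υ` moves a state at distance `ε`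
from `Υ` by at most `2 ε` (`traceNorm_sub_map_le`), so `ε`-decomposable states are `2 ε`-recoverable.

For the lower bounds, let `τ` be the randomized state on `n` copies. A mixture of `K` unitary
conjugates increases the entropy of `ρ^{⊗n}` by at most `log K` (subadditivity of `-Tr X log X` on
positive semidefinite matrices, `natEntropy_add_le`), does not decrease the entropy of `AB`
(concavity), and fixes the marginals on `BC` and `B`. Hence `n I(ρ) ≤ log K + I(τ)`
(`natCondMutualInfo_le_randomUnitary`). If `τ` is close to `ω = (Φ ⊗ id)(τ^{BC})`, data processing
says that the conditional entropy of `C` given `AB` in `ω` is at least that of `C` given `B` in `τ`,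
and so `I(τ)` is at most the difference of the conditional entropies of `C` given `AB` in `ω` and
in `τ`. A Fannes-type estimate (`natEntropy_le_of_add_eq_add`) bounds this by `ε n L + O(1)`, with `L`
depending only on the dimensions of `A`, `B`, `C`. Divide by `n` and let `n → ∞`, then `ε → 0`.
Recovery from `AB` is the same argument with the roles of `A` and `C` exchanged in this last part.

Data processing (`condEntropy_le_idTensor`) is monotonicity of the relative entropy `D(ρ‖σ)` with
respect to `σ = 1 ⊗ (ρ^B + η)`. If `p`, `q` are the eigenvalues of `ρ`, `σ`, and `V` is the matrix
of scalar products of their eigenvectors, then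
`∑ |V_{ji}|² p_i² / (s p_i + q_j) = max_Y (2 Re Tr Yρ - s Tr YρYᴴ - Tr YᴴσY)`.
By the Kadison–Schwarz inequality for the adjoint operation, the right-hand side does not increase
under quantum operations. Integrating the left-hand side over `0 ≤ s ≤ T`, subtracting `log T Tr ρ`
and letting `T → ∞` gives `D(ρ‖σ)` (`relativeEntropy_krausMap_le`).
-/

namespace Markovianization

open Matrix Real Filter Topology

/-! ### Diagonalizations -/

section Diag

variable {m n : Type*} [Fintype m] [DecidableEq m] [Fintype n] [DecidableEq n]

/-- `X = U D Uᴴ` with `U` unitary and `D` the diagonal matrix of the real numbers `d`. Working with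
arbitrary diagonalizations, and not only with the one chosen by the spectral theorem, makes it
possible to use product bases for product operators. -/
structure Diagonalizes (U : Matrix m m ℂ) (d : m → ℝ) (X : Matrix m m ℂ) : Prop where
  unitary : Uᴴ * U = 1
  eq : X = U * diagonal (fun i => (d i : ℂ)) * Uᴴ

theorem Diagonalizes.unitary' {U X : Matrix m m ℂ} {d : m → ℝ} (h : Diagonalizes U d X) :
    U * Uᴴ = 1 := mul_eq_one_comm.mp h.unitary

theorem _root_.Matrix.IsHermitian.diagonalizes {X : Matrix m m ℂ} (h : X.IsHermitian) :
    Diagonalizes (h.eigenvectorUnitary : Matrix m m ℂ) h.eigenvalues X where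
  unitary := by
    rw [← star_eq_conjTranspose]
    exact Unitary.coe_star_mul_self _
  eq := by
    have := h.spectral_theorem
    rw [Unitary.conjStarAlgAut_apply] at this
    exact this

theorem Diagonalizes.isHermitian {U X : Matrix m m ℂ} {d : m → ℝ} (h : Diagonalizes U d X) :
    X.IsHermitian := by
  rw [h.eq]
  apply isHermitian_mul_mul_conjTranspose
  rw [isHermitian_diagonal_iff]
  intro i
  simp [isSelfAdjoint_iff]

theorem Diagonalizes.conj {U X : Matrix m m ℂ} {d : m → ℝ} (h : Diagonalizes U d X)
    {V : Matrix m m ℂ} (hV : Vᴴ * V = 1) : Diagonalizes (V * U) d (V * X * Vᴴ) where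
  unitary := by
    rw [conjTranspose_mul, Matrix.mul_assoc, ← Matrix.mul_assoc Vᴴ, hV, Matrix.one_mul, h.unitary]
  eq := by
    rw [h.eq, conjTranspose_mul]
    simp only [Matrix.mul_assoc]

theorem Diagonalizes.submatrix {U X : Matrix m m ℂ} {d : m → ℝ} (h : Diagonalizes U d X)
    (e : n ≃ m) : Diagonalizes (U.submatrix e e) (d ∘ e) (X.submatrix e e) where
  unitary := by
    rw [conjTranspose_submatrix, submatrix_mul_equiv, h.unitary, submatrix_one_equiv]
  eq := by
    have : (diagonal fun i => (((d ∘ e) i : ℝ) : ℂ)) =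
        (diagonal fun i => (d i : ℂ)).submatrix e e := by
      rw [submatrix_diagonal_equiv]; rfl
    rw [this, conjTranspose_submatrix, submatrix_mul_equiv, submatrix_mul_equiv, ← h.eq]

theorem Diagonalizes.smul {U X : Matrix m m ℂ} {d : m → ℝ} (h : Diagonalizes U d X) (c : ℝ) :
    Diagonalizes U (fun i => c * d i) ((c : ℂ) • X) where
  unitary := h.unitary
  eq := by
    have : (diagonal fun i => ((c * d i : ℝ) : ℂ)) = (c : ℂ) • diagonal fun i => (d i : ℂ) := by
      rw [← diagonal_smul]; congr 1; ext i; simp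
    rw [h.eq, this]; simp

theorem Diagonalizes.add_smul_one {U X : Matrix m m ℂ} {d : m → ℝ} (h : Diagonalizes U d X)
    (c : ℝ) : Diagonalizes U (fun i => d i + c) (X + (c : ℂ) • 1) where
  unitary := h.unitary
  eq := by
    have : (diagonal fun i => ((d i + c : ℝ) : ℂ)) =
        (diagonal fun i => (d i : ℂ)) + (c : ℂ) • (1 : Matrix m m ℂ) := by
      rw [smul_one_eq_diagonal, diagonal_add]; simp
    rw [this, Matrix.mul_add, Matrix.add_mul, ← h.eq]
    simp [h.unitary']

theorem Diagonalizes.one_kronecker {U X : Matrix m m ℂ} {d : m → ℝ} (h : Diagonalizes U d X) :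
    Diagonalizes ((1 : Matrix n n ℂ) ⊗ₖ U) (fun p => d p.2) ((1 : Matrix n n ℂ) ⊗ₖ X) where
  unitary := by
    rw [conjTranspose_kronecker, ← mul_kronecker_mul, h.unitary]; simp
  eq := by
    have : (diagonal fun p : n × m => ((d p.2 : ℝ) : ℂ)) =
        (1 : Matrix n n ℂ) ⊗ₖ (diagonal fun i => (d i : ℂ)) := by
      rw [← diagonal_one, diagonal_kronecker_diagonal]; simp
    rw [this, conjTranspose_kronecker, ← mul_kronecker_mul, ← mul_kronecker_mul, ← h.eq]; simp

theorem Diagonalizes.trace {U X : Matrix m m ℂ} {d : m → ℝ} (h : Diagonalizes U d X) :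
    X.trace = ((∑ i, d i : ℝ) : ℂ) := by
  rw [h.eq, trace_mul_cycle, h.unitary, Matrix.one_mul, trace_diagonal]; simp

theorem Diagonalizes.posSemidef {U X : Matrix m m ℂ} {d : m → ℝ} (h : Diagonalizes U d X)
    (hd : ∀ i, 0 ≤ d i) : X.PosSemidef := by
  rw [h.eq]
  refine PosSemidef.mul_mul_conjTranspose_same ?_ _
  rw [posSemidef_diagonal_iff]
  intro i
  exact_mod_cast hd i

/-- If `W` is unitary, this says that the diagonal coefficients of `X` in the basis `W` are averages
of its eigenvalues. -/
theorem Diagonalizes.conj_apply_self {U X : Matrix m m ℂ} {d : m → ℝ} (h : Diagonalizes U d X)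
    (W : Matrix m m ℂ) (k : m) :
    (Wᴴ * X * W) k k = ((∑ i, ‖(Wᴴ * U) k i‖ ^ 2 * d i : ℝ) : ℂ) := by
  have : Wᴴ * X * W = (Wᴴ * U) * diagonal (fun i => (d i : ℂ)) * (Wᴴ * U)ᴴ := by
    rw [h.eq, conjTranspose_mul, conjTranspose_conjTranspose]; simp only [Matrix.mul_assoc]
  rw [this, Matrix.mul_apply]
  push_cast
  refine Finset.sum_congr rfl fun i _ => ?_
  rw [mul_diagonal, conjTranspose_apply]
  have := Complex.mul_conj' ((Wᴴ * U) k i)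
  rw [← starRingEnd_apply, mul_right_comm, this]

theorem Diagonalizes.eigenvalue_eq {U X : Matrix m m ℂ} {d : m → ℝ} (h : Diagonalizes U d X)
    (k : m) : ((Uᴴ * X * U) k k).re = d k := by
  rw [h.conj_apply_self U k, h.unitary, Complex.ofReal_re, Finset.sum_eq_single k]
  · simp
  · intro i _ hi; simp [Matrix.one_apply_ne hi.symm]
  · simp

theorem Diagonalizes.nonneg {U X : Matrix m m ℂ} {d : m → ℝ} (h : Diagonalizes U d X)
    (hX : X.PosSemidef) (i : m) : 0 ≤ d i := by
  rw [← h.eigenvalue_eq i]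
  exact (Complex.le_def.mp (hX.conjTranspose_mul_mul_same U).diag_nonneg).1

theorem sum_normSq_row {V : Matrix m m ℂ} (hV : V * Vᴴ = 1) (k : m) : ∑ i, ‖V k i‖ ^ 2 = 1 := by
  have := congrFun (congrFun hV k) k
  rw [Matrix.mul_apply, one_apply_eq] at this
  have h2 : ((∑ i, ‖V k i‖ ^ 2 : ℝ) : ℂ) = 1 := by
    rw [← this]; push_cast
    refine Finset.sum_congr rfl fun i _ => ?_
    rw [conjTranspose_apply, ← Complex.mul_conj', starRingEnd_apply]
  exact_mod_cast h2

theorem sum_normSq_col {V : Matrix m m ℂ} (hV : Vᴴ * V = 1) (i : m) : ∑ k, ‖V k i‖ ^ 2 = 1 := by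
  have := sum_normSq_row (V := Vᴴ) (by simpa using hV) i
  simpa using this

/-- Two diagonalizations of the same matrix have the same eigenvalues with multiplicities. -/
theorem Diagonalizes.sum_eq {U X : Matrix m m ℂ} {d : m → ℝ} (h : Diagonalizes U d X)
    (hX : X.IsHermitian) (g : ℝ → ℝ) : ∑ i, g (hX.eigenvalues i) = ∑ i, g (d i) := by
  have hc : X.charpoly = ∏ i, (Polynomial.X - Polynomial.C ((d i : ℝ) : ℂ)) := by
    rw [h.eq, charpoly_mul_comm, ← Matrix.mul_assoc, h.unitary, Matrix.one_mul, charpoly_diagonal]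
  have h1 := hX.roots_charpoly_eq_eigenvalues
  rw [hc, Polynomial.roots_prod _ _ (Finset.prod_ne_zero_iff.mpr
    fun i _ => Polynomial.X_sub_C_ne_zero _)] at h1
  simp only [Polynomial.roots_X_sub_C, Multiset.bind_singleton] at h1
  have h2 := congrArg (Multiset.map fun z : ℂ => g z.re) h1
  simp only [Multiset.map_map, Function.comp_def, Complex.ofReal_re] at h2
  have h3 := congrArg Multiset.sum h2
  exact h3.symm

end Diag

/-! ### Entropy in natural units -/

section Entropy

variable {m n : Type*} [Fintype m] [DecidableEq m] [Fintype n]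

/-- The von Neumann entropy `-Tr X log X` with the natural logarithm. It is used for arbitrary
positive semidefinite `X`, whatever the trace. -/
noncomputable def natEntropy (X : Matrix m m ℂ) : ℝ := entropy X * Real.log 2

theorem Diagonalizes.natEntropy_eq {U X : Matrix m m ℂ} {d : m → ℝ} (h : Diagonalizes U d X) :
    natEntropy X = ∑ i, negMulLog (d i) := by
  have h2 : Real.log 2 ≠ 0 := (Real.log_pos one_lt_two).ne'
  rw [natEntropy, entropy, dif_pos h.isHermitian, Finset.sum_mul,
    h.sum_eq h.isHermitian fun x => negMulLog x / Real.log 2 * Real.log 2]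
  exact Finset.sum_congr rfl fun i _ => div_mul_cancel₀ _ h2

theorem natEntropy_conj {X V : Matrix m m ℂ} (hX : X.IsHermitian) (hV : Vᴴ * V = 1) :
    natEntropy (V * X * Vᴴ) = natEntropy X := by
  rw [(hX.diagonalizes.conj hV).natEntropy_eq, hX.diagonalizes.natEntropy_eq]

theorem natEntropy_submatrix [DecidableEq n] {X : Matrix m m ℂ} (hX : X.IsHermitian) (e : n ≃ m) :
    natEntropy (X.submatrix e e) = natEntropy X := by
  rw [(hX.diagonalizes.submatrix e).natEntropy_eq, hX.diagonalizes.natEntropy_eq]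
  exact Equiv.sum_comp e fun i => negMulLog (hX.eigenvalues i)

theorem natEntropy_smul {X : Matrix m m ℂ} (hX : X.IsHermitian) (c : ℝ) :
    natEntropy ((c : ℂ) • X) = c * natEntropy X + negMulLog c * X.trace.re := by
  rw [(hX.diagonalizes.smul c).natEntropy_eq, hX.diagonalizes.natEntropy_eq,
    hX.diagonalizes.trace, Complex.ofReal_re, Finset.mul_sum, Finset.mul_sum,
    ← Finset.sum_add_distrib]
  refine Finset.sum_congr rfl fun i _ => ?_
  rw [negMulLog_mul]; ring

theorem natEntropy_zero : natEntropy (0 : Matrix m m ℂ) = 0 := by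
  have := natEntropy_smul (isHermitian_zero (n := m) (α := ℂ)) 0
  simpa using this

/-- The entropy is at most the entropy of the diagonal distribution in any orthonormal basis. -/
theorem natEntropy_le_sum_diag {X W : Matrix m m ℂ} (hX : X.PosSemidef) (hW : Wᴴ * W = 1) :
    natEntropy X ≤ ∑ k, negMulLog ((Wᴴ * X * W) k k).re := by
  have h := hX.isHermitian.diagonalizes
  set U := (hX.isHermitian.eigenvectorUnitary : Matrix m m ℂ)
  set d := hX.isHermitian.eigenvalues
  have hW' : W * Wᴴ = 1 := mul_eq_one_comm.mp hW
  have hrow : (Wᴴ * U) * (Wᴴ * U)ᴴ = 1 := by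
    rw [conjTranspose_mul, conjTranspose_conjTranspose, Matrix.mul_assoc, ← Matrix.mul_assoc U,
      h.unitary', Matrix.one_mul, hW]
  have hcol : (Wᴴ * U)ᴴ * (Wᴴ * U) = 1 := mul_eq_one_comm.mp hrow
  rw [h.natEntropy_eq]
  calc ∑ i, negMulLog (d i) = ∑ i, (∑ k, ‖(Wᴴ * U) k i‖ ^ 2) * negMulLog (d i) := by
        simp only [sum_normSq_col hcol, one_mul]
    _ = ∑ k, ∑ i, ‖(Wᴴ * U) k i‖ ^ 2 * negMulLog (d i) := by
        simp only [Finset.sum_mul]; exact Finset.sum_comm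
    _ ≤ _ := by
        refine Finset.sum_le_sum fun k _ => ?_
        rw [h.conj_apply_self W k, Complex.ofReal_re]
        have := concaveOn_negMulLog.le_map_sum (t := Finset.univ)
          (w := fun i => ‖(Wᴴ * U) k i‖ ^ 2) (p := d) (fun i _ => by positivity)
          (sum_normSq_row hrow k) (fun i _ => h.nonneg hX i)
        simpa only [smul_eq_mul] using this

/-- Concavity of the entropy. -/
theorem sum_smul_natEntropy_le {ι : Type*} (s : Finset ι) (w : ι → ℝ) (X : ι → Matrix m m ℂ)
    (hw : ∀ i ∈ s, 0 ≤ w i) (hw1 : ∑ i ∈ s, w i = 1) (hX : ∀ i ∈ s, (X i).PosSemidef) :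
    ∑ i ∈ s, w i * natEntropy (X i) ≤ natEntropy (∑ i ∈ s, (w i : ℂ) • X i) := by
  have hZ : (∑ i ∈ s, (w i : ℂ) • X i).PosSemidef :=
    posSemidef_sum s fun i hi => (hX i hi).smul (by exact_mod_cast hw i hi)
  have h := hZ.isHermitian.diagonalizes
  set U := (hZ.isHermitian.eigenvectorUnitary : Matrix m m ℂ)
  have key : ∀ k, ((Uᴴ * (∑ i ∈ s, (w i : ℂ) • X i) * U) k k).re =
      ∑ i ∈ s, w i * ((Uᴴ * X i * U) k k).re := by
    intro k
    simp [Matrix.mul_sum, Matrix.sum_mul, Matrix.sum_apply, Complex.re_sum]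
  calc ∑ i ∈ s, w i * natEntropy (X i)
      ≤ ∑ i ∈ s, w i * ∑ k, negMulLog ((Uᴴ * X i * U) k k).re :=
        Finset.sum_le_sum fun i hi => mul_le_mul_of_nonneg_left
          (natEntropy_le_sum_diag (hX i hi) h.unitary) (hw i hi)
    _ = ∑ k, ∑ i ∈ s, w i * negMulLog ((Uᴴ * X i * U) k k).re := by
        simp only [Finset.mul_sum]; exact Finset.sum_comm
    _ ≤ ∑ k, negMulLog (∑ i ∈ s, w i * ((Uᴴ * X i * U) k k).re) := by
        refine Finset.sum_le_sum fun k _ => ?_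
        have := concaveOn_negMulLog.le_map_sum (t := s)
          (w := w) (p := fun i => ((Uᴴ * X i * U) k k).re) hw hw1
          (fun i hi => (Complex.le_def.mp
            ((hX i hi).conjTranspose_mul_mul_same U).diag_nonneg).1)
        simpa only [smul_eq_mul] using this
    _ = _ := by
        rw [h.natEntropy_eq]
        refine Finset.sum_congr rfl fun k _ => ?_
        rw [← key, h.eigenvalue_eq]

/-- If `Z = Mᴴ M`, the entropy of `Z` is at most that of the diagonal of `M Mᴴ`. The matrix
`N z⁻¹ Nᴴ`, where `N` is `M` in an eigenbasis of `Z` and `z` are the eigenvalues, is a projection,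
so that its diagonal entries, which serve as weights in Jensen's inequality, are at most `1`; the
missing weight goes to the point `0`. -/
theorem natEntropy_conjTranspose_mul_self_le (M : Matrix n m ℂ) :
    natEntropy (Mᴴ * M) ≤ ∑ k, negMulLog ((M * Mᴴ) k k).re := by
  have hZ := posSemidef_conjTranspose_mul_self M
  have h := hZ.isHermitian.diagonalizes
  set U := (hZ.isHermitian.eigenvectorUnitary : Matrix m m ℂ)
  set z := hZ.isHermitian.eigenvalues
  set N := M * U with hN
  have hz : ∀ l, 0 ≤ z l := h.nonneg hZ
  have hNN : Nᴴ * N = diagonal fun l => (z l : ℂ) := by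
    rw [hN, conjTranspose_mul, Matrix.mul_assoc, ← Matrix.mul_assoc Mᴴ, h.eq]
    simp only [Matrix.mul_assoc, h.unitary, Matrix.mul_one]
    rw [← Matrix.mul_assoc, h.unitary, Matrix.one_mul]
  have hMM : M * Mᴴ = N * Nᴴ := by
    rw [hN, conjTranspose_mul, Matrix.mul_assoc, ← Matrix.mul_assoc U, h.unitary', Matrix.one_mul]
  have hcol : ∀ l, ∑ k, ‖N k l‖ ^ 2 = z l := by
    intro l
    have := congrFun (congrFun hNN l) l
    rw [Matrix.mul_apply, diagonal_apply_eq] at this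
    have h2 : ((∑ k, ‖N k l‖ ^ 2 : ℝ) : ℂ) = (z l : ℂ) := by
      rw [← this]; push_cast
      refine Finset.sum_congr rfl fun k _ => ?_
      rw [conjTranspose_apply, ← Complex.conj_mul', starRingEnd_apply]
    exact_mod_cast h2
  have hdiag : ∀ k, ((M * Mᴴ) k k).re = ∑ l, ‖N k l‖ ^ 2 := by
    intro k
    have : (M * Mᴴ) k k = ((∑ l, ‖N k l‖ ^ 2 : ℝ) : ℂ) := by
      rw [hMM, Matrix.mul_apply]; push_cast
      refine Finset.sum_congr rfl fun l _ => ?_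
      rw [conjTranspose_apply, ← Complex.mul_conj', starRingEnd_apply]
    rw [this, Complex.ofReal_re]
  -- an eigenvalue `z l = 0` has a vanishing column in `N`, so division by it does no harm
  have hzero : ∀ k l, z l = 0 → ‖N k l‖ ^ 2 = 0 := by
    intro k l hl
    have := hcol l
    rw [hl] at this
    exact (Finset.sum_eq_zero_iff_of_nonneg fun k _ => by positivity).mp this k (Finset.mem_univ k)
  have hrow : ∀ k, ∑ l, ‖N k l‖ ^ 2 / z l ≤ 1 := by
    intro k
    set P : Matrix n n ℂ := N * diagonal (fun l => ((z l)⁻¹ : ℂ)) * Nᴴ with hP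
    have hPP : P * Pᴴ = P := by
      have hPH : Pᴴ = P := by
        rw [hP]; simp only [conjTranspose_mul, conjTranspose_conjTranspose,
          diagonal_conjTranspose, Matrix.mul_assoc]
        congr 3
        ext l; simp [Pi.star_apply]
      rw [hPH]
      calc P * P = N * (diagonal (fun l => ((z l)⁻¹ : ℂ)) * (Nᴴ * N) *
            diagonal (fun l => ((z l)⁻¹ : ℂ))) * Nᴴ := by
            rw [hP]; simp only [Matrix.mul_assoc]
        _ = P := by
            rw [hNN, diagonal_mul_diagonal, diagonal_mul_diagonal, hP]
            congr 3
            ext l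
            by_cases hl : (z l : ℂ) = 0
            · simp [hl]
            · field_simp
    have hPk : P k k = ((∑ l, ‖N k l‖ ^ 2 / z l : ℝ) : ℂ) := by
      rw [hP, Matrix.mul_apply]; push_cast
      refine Finset.sum_congr rfl fun l _ => ?_
      rw [mul_diagonal, conjTranspose_apply, ← Complex.mul_conj', starRingEnd_apply]; ring
    set t := ∑ l, ‖N k l‖ ^ 2 / z l
    have h1 : (t : ℂ) = ((∑ j, ‖P k j‖ ^ 2 : ℝ) : ℂ) := by
      rw [← hPk]; nth_rw 1 [← hPP]; rw [Matrix.mul_apply]; push_cast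
      refine Finset.sum_congr rfl fun l _ => ?_
      rw [conjTranspose_apply, ← Complex.mul_conj', starRingEnd_apply]
    have h2 : t = ∑ j, ‖P k j‖ ^ 2 := by exact_mod_cast h1
    have h3 : ‖P k k‖ ^ 2 ≤ ∑ j, ‖P k j‖ ^ 2 :=
      Finset.single_le_sum (f := fun j => ‖P k j‖ ^ 2) (fun j _ => by positivity)
        (Finset.mem_univ k)
    rw [← h2, hPk, Complex.norm_real, Real.norm_eq_abs, sq_abs] at h3
    nlinarith
  rw [h.natEntropy_eq]
  calc ∑ l, negMulLog (z l) = ∑ l, ∑ k, ‖N k l‖ ^ 2 / z l * negMulLog (z l) := by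
        refine Finset.sum_congr rfl fun l _ => ?_
        rw [← Finset.sum_mul, ← Finset.sum_div, hcol]
        by_cases hl : z l = 0
        · simp [hl]
        · rw [div_self hl, one_mul]
    _ = ∑ k, ∑ l, ‖N k l‖ ^ 2 / z l * negMulLog (z l) := Finset.sum_comm
    _ ≤ _ := by
        refine Finset.sum_le_sum fun k _ => ?_
        have := concaveOn_negMulLog.le_map_sum (t := Finset.univ (α := Option m))
          (w := fun o => o.elim (1 - ∑ l, ‖N k l‖ ^ 2 / z l) fun l => ‖N k l‖ ^ 2 / z l)
          (p := fun o => o.elim 0 z)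
          (by
            rintro (_ | l) _
            · simpa using hrow k
            · exact div_nonneg (by positivity) (hz l))
          (by simp [Fintype.sum_option])
          (by
            rintro (_ | l) _
            · simp
            · exact hz l)
        simp only [Fintype.sum_option, Option.elim, smul_eq_mul, negMulLog_zero, mul_zero,
          zero_add] at this
        refine this.trans_eq ?_
        rw [hdiag]
        congr 1
        refine Finset.sum_congr rfl fun l _ => ?_
        by_cases hl : z l = 0
        · rw [hzero k l hl]; simp
        · exact div_mul_cancel₀ _ hl

/-- Subadditivity: write `X + Y = Mᴴ M` where the rows of `M` are scaled eigenvectors of `X` and of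
`Y`; then the diagonal of `M Mᴴ` consists of the eigenvalues of `X` and of `Y`. -/
theorem natEntropy_add_le {X Y : Matrix m m ℂ} (hX : X.PosSemidef) (hY : Y.PosSemidef) :
    natEntropy (X + Y) ≤ natEntropy X + natEntropy Y := by
  obtain ⟨U, x, h⟩ : ∃ U x, Diagonalizes U x X := ⟨_, _, hX.isHermitian.diagonalizes⟩
  obtain ⟨V, y, h'⟩ : ∃ U x, Diagonalizes U x Y := ⟨_, _, hY.isHermitian.diagonalizes⟩
  have hsq : ∀ (U X : Matrix m m ℂ) (x : m → ℝ), Diagonalizes U x X → X.PosSemidef →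
      ((diagonal fun i => ((√(x i) : ℝ) : ℂ)) * Uᴴ)ᴴ *
        ((diagonal fun i => ((√(x i) : ℝ) : ℂ)) * Uᴴ) = X ∧
      ∀ k, (((diagonal fun i => ((√(x i) : ℝ) : ℂ)) * Uᴴ) *
        ((diagonal fun i => ((√(x i) : ℝ) : ℂ)) * Uᴴ)ᴴ) k k = x k := by
    intro U X x h hX
    have hD : (diagonal fun i => ((√(x i) : ℝ) : ℂ))ᴴ = diagonal fun i => ((√(x i) : ℝ) : ℂ) := by
      rw [diagonal_conjTranspose]; congr 1; ext i; simp
    have hs : ∀ i, ((√(x i) : ℝ) : ℂ) * ((√(x i) : ℝ) : ℂ) = x i := by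
      intro i; rw [← Complex.ofReal_mul, Real.mul_self_sqrt (h.nonneg hX i)]
    rw [conjTranspose_mul, conjTranspose_conjTranspose, hD]
    constructor
    · rw [Matrix.mul_assoc, ← Matrix.mul_assoc (diagonal _), diagonal_mul_diagonal]
      simp only [hs]
      rw [← Matrix.mul_assoc, ← h.eq]
    · intro k
      rw [Matrix.mul_assoc, ← Matrix.mul_assoc Uᴴ, h.unitary, Matrix.one_mul,
        diagonal_mul_diagonal, diagonal_apply_eq, hs]
  obtain ⟨hX1, hX2⟩ := hsq U X x h hX
  obtain ⟨hY1, hY2⟩ := hsq V Y y h' hY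
  have key := natEntropy_conjTranspose_mul_self_le
    (fromRows ((diagonal fun i => ((√(x i) : ℝ) : ℂ)) * Uᴴ)
      ((diagonal fun i => ((√(y i) : ℝ) : ℂ)) * Vᴴ))
  rw [conjTranspose_fromRows_eq_fromCols_conjTranspose, fromCols_mul_fromRows, hX1, hY1,
    fromRows_mul_fromCols, Fintype.sum_sum_type] at key
  simpa only [fromBlocks_apply₁₁, fromBlocks_apply₂₂, hX2, hY2, Complex.ofReal_re,
    ← h.natEntropy_eq, ← h'.natEntropy_eq] using key

theorem natEntropy_sum_le {ι : Type*} (s : Finset ι) (X : ι → Matrix m m ℂ)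
    (hX : ∀ i ∈ s, (X i).PosSemidef) :
    natEntropy (∑ i ∈ s, X i) ≤ ∑ i ∈ s, natEntropy (X i) := by
  classical
  induction s using Finset.induction_on with
  | empty => simp [natEntropy_zero]
  | insert a s ha ih =>
    rw [Finset.sum_insert ha, Finset.sum_insert ha]
    have hs : ∀ i ∈ s, (X i).PosSemidef := fun i hi => hX i (Finset.mem_insert_of_mem hi)
    refine (natEntropy_add_le (hX a (Finset.mem_insert_self a s)) (posSemidef_sum s hs)).trans ?_
    gcongr
    exact ih hs

/-- An entropy bound that is useful for matrices of small trace. -/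
theorem natEntropy_le_trace_mul_log {X : Matrix m m ℂ} (hX : X.PosSemidef) :
    natEntropy X ≤ X.trace.re * Real.log (Fintype.card m) + 1 := by
  have h := hX.isHermitian.diagonalizes
  set d := hX.isHermitian.eigenvalues
  rw [h.natEntropy_eq, h.trace, Complex.ofReal_re]
  rcases isEmpty_or_nonempty m with hm | hm
  · simp
  set D : ℝ := (Fintype.card m : ℝ) with hD
  have hD0 : 0 < D := by rw [hD]; exact_mod_cast Fintype.card_pos
  have h1 : ∀ i, negMulLog (d i) ≤ d i * Real.log D + D⁻¹ := by
    intro i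
    have hi := h.nonneg hX i
    rcases hi.eq_or_lt with h0 | h0
    · rw [← h0]; simp [hD0.le]
    -- tangent to `negMulLog` at `1 / D`
    · have := Real.log_le_sub_one_of_pos (x := (d i * D)⁻¹) (by positivity)
      rw [Real.log_inv, Real.log_mul h0.ne' hD0.ne'] at this
      have h2 : d i * (-(Real.log (d i) + Real.log D)) ≤ d i * ((d i * D)⁻¹ - 1) :=
        mul_le_mul_of_nonneg_left this hi
      have h3 : d i * ((d i * D)⁻¹ - 1) = D⁻¹ - d i := by field_simp
      rw [negMulLog]
      linarith
  calc ∑ i, negMulLog (d i) ≤ ∑ i, (d i * Real.log D + D⁻¹) := Finset.sum_le_sum fun i _ => h1 i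
    _ = _ := by
      rw [Finset.sum_add_distrib, ← Finset.sum_mul]
      simp [← hD, hD0.ne']

theorem negMulLog_sub_le {a b : ℝ} (ha : 0 ≤ a) (hb : 0 ≤ b) :
    negMulLog a - b * (a + b) ≤ negMulLog (a + b) := by
  rcases ha.eq_or_lt with h0 | h0
  · rw [← h0]
    rcases hb.eq_or_lt with hb0 | hb0
    · simp [← hb0]
    · have := Real.log_le_sub_one_of_pos hb0
      simp only [negMulLog, zero_add, neg_zero, zero_mul, zero_sub]
      nlinarith
  · have hab : 0 < a + b := by linarith
    have h1 := Real.log_le_sub_one_of_pos hab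
    have h2 := Real.log_le_sub_one_of_pos (x := (a + b) / a) (by positivity)
    rw [Real.log_div hab.ne' h0.ne'] at h2
    have h3 : a * (Real.log (a + b) - Real.log a) ≤ a * ((a + b) / a - 1) :=
      mul_le_mul_of_nonneg_left h2 ha
    have h4 : a * ((a + b) / a - 1) = b := by field_simp; ring
    have h5 := mul_le_mul_of_nonneg_left h1 hb
    simp only [negMulLog]
    linarith

/-- Adding a positive semidefinite matrix of small trace hardly decreases the entropy of a state. -/
theorem natEntropy_le_natEntropy_add {X P : Matrix m m ℂ} {δ : ℝ} (hX : X.PosSemidef)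
    (hX1 : X.trace = 1) (hP : P.PosSemidef) (hδ : P.trace.re ≤ δ) :
    natEntropy X ≤ natEntropy (X + P) + δ * (1 + δ) := by
  have h := (hX.add hP).isHermitian.diagonalizes
  set U := ((hX.add hP).isHermitian.eigenvectorUnitary : Matrix m m ℂ)
  set d := (hX.add hP).isHermitian.eigenvalues
  set a := fun k => ((Uᴴ * X * U) k k).re
  set b := fun k => ((Uᴴ * P * U) k k).re
  have ha : ∀ k, 0 ≤ a k := fun k =>
    (Complex.le_def.mp (hX.conjTranspose_mul_mul_same U).diag_nonneg).1
  have hb : ∀ k, 0 ≤ b k := fun k =>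
    (Complex.le_def.mp (hP.conjTranspose_mul_mul_same U).diag_nonneg).1
  have hd : ∀ k, d k = a k + b k := by
    intro k
    rw [← h.eigenvalue_eq k, Matrix.mul_add, Matrix.add_mul]; simp [a, b]
  have htr : ∀ Y : Matrix m m ℂ, ∑ k, ((Uᴴ * Y * U) k k).re = Y.trace.re := by
    intro Y
    rw [← Complex.re_sum]
    change (Matrix.trace (Uᴴ * Y * U)).re = _
    rw [trace_mul_cycle, h.unitary', Matrix.one_mul]
  have hsa : ∑ k, a k = 1 := by simp [a, htr X, hX1]
  have hsb : ∑ k, b k ≤ δ := by simpa [b, htr P] using hδ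
  have hab : ∀ k, a k + b k ≤ 1 + δ := by
    intro k
    have h1 := Finset.single_le_sum (fun k _ => ha k) (Finset.mem_univ k)
    have h2 := Finset.single_le_sum (fun k _ => hb k) (Finset.mem_univ k)
    linarith
  have hδ0 : 0 ≤ δ := (Finset.sum_nonneg fun k _ => hb k).trans hsb
  have h1 : ∑ k, negMulLog (a k) - δ * (1 + δ) ≤ ∑ k, negMulLog (d k) := by
    calc _ ≤ ∑ k, negMulLog (a k) - ∑ k, b k * (1 + δ) := by
          rw [← Finset.sum_mul]
          gcongr
      _ = ∑ k, (negMulLog (a k) - b k * (1 + δ)) := Finset.sum_sub_distrib ..|>.symm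
      _ ≤ _ := by
          refine Finset.sum_le_sum fun k _ => ?_
          rw [hd k]
          refine le_trans ?_ (negMulLog_sub_le (ha k) (hb k))
          have := mul_le_mul_of_nonneg_left (hab k) (hb k)
          linarith
  have h2 := natEntropy_le_sum_diag hX h.unitary
  rw [h.natEntropy_eq]
  linarith

/-- A Fannes-type continuity estimate: states that differ by a difference of positive semidefinite
matrices of trace at most `δ` have entropies that differ by `δ log D + O(1)`. -/
theorem natEntropy_le_of_add_eq_add {X Y P N : Matrix m m ℂ} {δ : ℝ} (hX : X.PosSemidef)
    (hX1 : X.trace = 1) (hY : Y.PosSemidef) (hP : P.PosSemidef) (hN : N.PosSemidef)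
    (h : X + P = Y + N) (hPδ : P.trace.re ≤ δ) (hNδ : N.trace.re ≤ δ) :
    natEntropy X ≤ natEntropy Y + δ * Real.log (Fintype.card m) + 1 + δ * (1 + δ) := by
  have h1 := natEntropy_le_natEntropy_add hX hX1 hP hPδ
  have h2 := natEntropy_add_le hY hN
  have h3 := natEntropy_le_trace_mul_log hN
  have h4 : N.trace.re * Real.log (Fintype.card m) ≤ δ * Real.log (Fintype.card m) :=
    mul_le_mul_of_nonneg_right hNδ (Real.log_natCast_nonneg _)
  rw [h] at h1
  linarith

end Entropy

/-! ### The trace norm of Hermitian matrices -/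

section TraceNorm

variable {m : Type*} [Fintype m] [DecidableEq m]

theorem Diagonalizes.traceNorm_eq {U X : Matrix m m ℂ} {d : m → ℝ} (h : Diagonalizes U d X) :
    traceNorm X = ∑ i, |d i| := by
  have h2 : Diagonalizes U (fun i => d i ^ 2) (Xᴴ * X) := by
    refine ⟨h.unitary, ?_⟩
    rw [h.isHermitian.eq]
    nth_rw 1 [h.eq]
    nth_rw 1 [h.eq]
    calc _ = U * (diagonal (fun i => (d i : ℂ)) * (Uᴴ * U) * diagonal (fun i => (d i : ℂ))) *
          Uᴴ := by
          simp only [Matrix.mul_assoc]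
      _ = _ := by
          rw [h.unitary, Matrix.mul_one, diagonal_mul_diagonal]
          simp [sq]
  rw [traceNorm, h2.sum_eq (isHermitian_conjTranspose_mul_self X) Real.sqrt]
  simp only [Real.sqrt_sq_eq_abs]

theorem traceNorm_sub_le {P N : Matrix m m ℂ} (hP : P.PosSemidef) (hN : N.PosSemidef) :
    traceNorm (P - N) ≤ P.trace.re + N.trace.re := by
  have h := (hP.isHermitian.sub hN.isHermitian).diagonalizes
  set U := ((hP.isHermitian.sub hN.isHermitian).eigenvectorUnitary : Matrix m m ℂ)
  set d := (hP.isHermitian.sub hN.isHermitian).eigenvalues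
  have htr : ∀ Y : Matrix m m ℂ, ∑ k, ((Uᴴ * Y * U) k k).re = Y.trace.re := by
    intro Y
    rw [← Complex.re_sum]
    change (Matrix.trace (Uᴴ * Y * U)).re = _
    rw [trace_mul_cycle, h.unitary', Matrix.one_mul]
  rw [h.traceNorm_eq, ← htr P, ← htr N, ← Finset.sum_add_distrib]
  refine Finset.sum_le_sum fun k _ => ?_
  have ha := (Complex.le_def.mp ((hP.conjTranspose_mul_mul_same U).diag_nonneg (i := k))).1
  have hb := (Complex.le_def.mp ((hN.conjTranspose_mul_mul_same U).diag_nonneg (i := k))).1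
  rw [← h.eigenvalue_eq k, Matrix.mul_sub, Matrix.sub_mul, Matrix.sub_apply, Complex.sub_re, abs_le]
  simp only [Complex.zero_re] at ha hb
  constructor <;> linarith

/-- The Jordan decomposition of a Hermitian matrix attains the trace norm. -/
theorem exists_eq_sub_of_isHermitian {X : Matrix m m ℂ} (hX : X.IsHermitian) :
    ∃ P N : Matrix m m ℂ, P.PosSemidef ∧ N.PosSemidef ∧ X = P - N ∧
      P.trace.re + N.trace.re = traceNorm X := by
  have h := hX.diagonalizes
  set U := (hX.eigenvectorUnitary : Matrix m m ℂ)
  set d := hX.eigenvalues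
  have hP : Diagonalizes U (fun i => max (d i) 0)
    (U * diagonal (fun i => ((max (d i) 0 : ℝ) : ℂ)) * Uᴴ) := ⟨h.unitary, rfl⟩
  have hN : Diagonalizes U (fun i => max (-d i) 0)
    (U * diagonal (fun i => ((max (-d i) 0 : ℝ) : ℂ)) * Uᴴ) := ⟨h.unitary, rfl⟩
  refine ⟨_, _, hP.posSemidef fun i => le_max_right _ _, hN.posSemidef fun i => le_max_right _ _,
    ?_, ?_⟩
  · rw [← Matrix.sub_mul, ← Matrix.mul_sub, diagonal_sub]
    refine h.eq.trans ?_
    congr 3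
    ext i
    rw [← Complex.ofReal_sub]
    congr 1
    rcases le_total (d i) 0 with h0 | h0
    · rw [max_eq_right h0, max_eq_left (by linarith)]; ring
    · rw [max_eq_left h0, max_eq_right (by linarith)]; ring
  · rw [hP.trace, hN.trace, h.traceNorm_eq, Complex.ofReal_re, Complex.ofReal_re,
      ← Finset.sum_add_distrib]
    refine Finset.sum_congr rfl fun i _ => ?_
    rcases le_total (d i) 0 with h0 | h0
    · rw [max_eq_right h0, max_eq_left (by linarith), abs_of_nonpos h0]; ring
    · rw [max_eq_left h0, max_eq_right (by linarith), abs_of_nonneg h0]; ring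

end TraceNorm

/-! ### Kraus maps -/

section Kraus

variable {ι m n k : Type*} [Fintype ι] [Fintype m]

/-- The completely positive map `X ↦ ∑ᵢ Kᵢ X Kᵢᴴ` with Kraus operators `Kᵢ`. -/
noncomputable def krausMap (K : ι → Matrix n m ℂ) : Matrix m m ℂ →ₗ[ℂ] Matrix n n ℂ where
  toFun X := ∑ i, K i * X * (K i)ᴴ
  map_add' X Y := by simp only [Matrix.mul_add, Matrix.add_mul, Finset.sum_add_distrib]
  map_smul' c X := by
    simp only [Matrix.mul_smul, Matrix.smul_mul, Finset.smul_sum, RingHom.id_apply]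

theorem krausMap_apply (K : ι → Matrix n m ℂ) (X : Matrix m m ℂ) :
    krausMap K X = ∑ i, K i * X * (K i)ᴴ := rfl

theorem krausMap_apply_apply (K : ι → Matrix n m ℂ) (X : Matrix m m ℂ) (a b : n) :
    krausMap K X a b = ∑ i, ∑ y, ∑ x, K i a x * X x y * star (K i b y) := by
  rw [krausMap_apply, Matrix.sum_apply]
  refine Finset.sum_congr rfl fun i _ => ?_
  rw [Matrix.mul_apply]
  refine Finset.sum_congr rfl fun y _ => ?_
  rw [Matrix.mul_apply, Finset.sum_mul]
  rfl

theorem posSemidef_krausMap [Fintype n] (K : ι → Matrix n m ℂ) {X : Matrix m m ℂ}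
    (hX : X.PosSemidef) : (krausMap K X).PosSemidef :=
  posSemidef_sum _ fun i _ => hX.mul_mul_conjTranspose_same (K i)

theorem trace_krausMap [Fintype n] [DecidableEq m] (K : ι → Matrix n m ℂ)
    (hK : ∑ i, (K i)ᴴ * K i = 1) (X : Matrix m m ℂ) : (krausMap K X).trace = X.trace := by
  calc (krausMap K X).trace = ∑ i, ((K i)ᴴ * K i * X).trace := by
        rw [krausMap_apply, trace_sum]
        exact Finset.sum_congr rfl fun i _ => trace_mul_cycle _ _ _
    _ = X.trace := by rw [← trace_sum, ← Finset.sum_mul, hK, Matrix.one_mul]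

omit [Fintype m] in
theorem idTensor_apply (Φ : Matrix m m ℂ →ₗ[ℂ] Matrix n n ℂ) (X : Matrix (k × m) (k × m) ℂ)
    (p q : k × n) :
    idTensor k Φ X p q = Φ (Matrix.of fun i j => X (p.1, i) (q.1, j)) p.2 q.2 := rfl

theorem idTensor_krausMap [Fintype k] [DecidableEq k] (K : ι → Matrix n m ℂ)
    (X : Matrix (k × m) (k × m) ℂ) :
    idTensor k (krausMap K) X = krausMap (fun i => (1 : Matrix k k ℂ) ⊗ₖ K i) X := by
  ext ⟨c, a⟩ ⟨d, b⟩
  rw [idTensor_apply, krausMap_apply_apply, krausMap_apply_apply]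
  refine Finset.sum_congr rfl fun i _ => ?_
  simp [Fintype.sum_prod_type, Matrix.one_apply, Finset.sum_ite_eq, apply_ite star]

omit [Fintype m] in
theorem sum_conjTranspose_mul_one_kronecker [Fintype n] [Fintype k] [DecidableEq k] [DecidableEq m]
    {K : ι → Matrix n m ℂ} (hK : ∑ i, (K i)ᴴ * K i = 1) :
    ∑ i, ((1 : Matrix k k ℂ) ⊗ₖ K i)ᴴ * ((1 : Matrix k k ℂ) ⊗ₖ K i) = 1 := by
  simp only [conjTranspose_kronecker, ← mul_kronecker_mul, conjTranspose_one, Matrix.one_mul]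
  have := map_sum (kroneckerBilinear (R := ℂ) (1 : Matrix k k ℂ) :
      Matrix m m ℂ →ₗ[ℂ] Matrix (k × m) (k × m) ℂ)
    (fun i => (K i)ᴴ * K i) Finset.univ
  rw [hK] at this
  rw [← one_kronecker_one]
  exact this.symm

theorem isQuantumOperation_krausMap [Fintype n] [DecidableEq m] {K : ι → Matrix n m ℂ}
    (hK : ∑ i, (K i)ᴴ * K i = 1) : IsQuantumOperation (krausMap K) where
  completelyPositive d X hX := by
    rw [idTensor_krausMap]; exact posSemidef_krausMap _ hX
  tracePreserving := trace_krausMap K hK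

/-- Every quantum operation has a Kraus decomposition, read off from a decomposition of its Choi
matrix into rank-one matrices. -/
theorem IsQuantumOperation.exists_kraus [Fintype n] [DecidableEq m] [DecidableEq n]
    {Φ : Matrix m m ℂ →ₗ[ℂ] Matrix n n ℂ} (hΦ : IsQuantumOperation Φ) :
    ∃ (r : ℕ) (K : Fin r → Matrix n m ℂ), Φ = krausMap K ∧ ∑ i, (K i)ᴴ * K i = 1 := by
  let e := Fintype.equivFin m
  let ψ : Fin (Fintype.card m) × m → ℂ := fun p => if p.1 = e p.2 then 1 else 0
  have hJ := hΦ.completelyPositive _ _ (posSemidef_vecMulVec_self_star ψ)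
  obtain ⟨r, v, hv⟩ := posSemidef_iff_eq_sum_vecMulVec.mp hJ
  have hE : ∀ i j a b, Φ (single i j 1) a b =
      idTensor (Fin (Fintype.card m)) Φ (vecMulVec ψ (star ψ)) (e i, a) (e j, b) := by
    intro i j a b
    have : single i j (1 : ℂ) =
        Matrix.of fun x y => vecMulVec ψ (star ψ) (e i, x) (e j, y) := by
      refine Matrix.ext fun x y => ?_
      simp only [vecMulVec_apply, single_apply, ψ, Pi.star_apply, e.apply_eq_iff_eq, of_apply]
      split_ifs <;> simp_all
    rw [idTensor_apply, this]
  have hΦ' : Φ = krausMap fun l => Matrix.of fun a i => v l (e i, a) := by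
    apply Matrix.ext_linearMap ℂ
    intro i j
    refine LinearMap.ext_ring (Matrix.ext fun a b => ?_)
    change Φ (single i j 1) a b =
      krausMap (fun l => Matrix.of fun a i => v l (e i, a)) (single i j 1) a b
    rw [hE, hv, krausMap_apply_apply, Matrix.sum_apply]
    refine Finset.sum_congr rfl fun l _ => ?_
    rw [Finset.sum_eq_single j, Finset.sum_eq_single i]
    · simp [vecMulVec_apply]
    · intro x _ hx; simp [hx.symm]
    · simp
    · intro y _ hy
      refine Finset.sum_eq_zero fun x _ => ?_
      simp [hy.symm]
    · simp
  refine ⟨r, _, hΦ', ?_⟩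
  rw [ext_iff_trace_mul_right]
  intro X
  rw [Matrix.one_mul, ← hΦ.tracePreserving X]
  rw [hΦ']
  rw [Finset.sum_mul, trace_sum, krausMap_apply, trace_sum]
  exact Finset.sum_congr rfl fun i _ => (trace_mul_cycle _ _ _).symm

/-- The Kadison–Schwarz inequality for the adjoint `Y ↦ ∑ᵢ Kᵢᴴ Y Kᵢ` of a quantum operation, tested
on a positive semidefinite `τ`. The difference of the two sides is the trace of
`∑ᵢ (Y Kᵢ - Kᵢ Z) τ (Y Kᵢ - Kᵢ Z)ᴴ`, where `Z` is the image of `Y`. -/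
theorem trace_kadison_schwarz [Fintype n] [DecidableEq m] {K : ι → Matrix n m ℂ}
    (hK : ∑ i, (K i)ᴴ * K i = 1) {τ : Matrix m m ℂ} (hτ : τ.PosSemidef) (Y : Matrix n n ℂ) :
    ((∑ i, (K i)ᴴ * Y * K i) * τ * (∑ i, (K i)ᴴ * Y * K i)ᴴ).trace.re ≤
      (Y * krausMap K τ * Yᴴ).trace.re := by
  set Z := ∑ i, (K i)ᴴ * Y * K i with hZ
  have hZH : Zᴴ = ∑ i, (K i)ᴴ * Yᴴ * K i := by
    rw [hZ, conjTranspose_sum]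
    simp [conjTranspose_mul, Matrix.mul_assoc]
  have hpos : (∑ i, (Y * K i - K i * Z) * τ * (Y * K i - K i * Z)ᴴ).PosSemidef :=
    posSemidef_sum _ fun i _ => hτ.mul_mul_conjTranspose_same _
  have h1 : (∑ i, (Y * K i - K i * Z) * τ * (Y * K i - K i * Z)ᴴ).trace =
      (Y * krausMap K τ * Yᴴ).trace - (Z * τ * Zᴴ).trace := by
    have e : ∀ i, ((Y * K i - K i * Z) * τ * (Y * K i - K i * Z)ᴴ).trace =
        (Y * (K i * τ * (K i)ᴴ) * Yᴴ).trace - ((K i)ᴴ * Y * K i * (τ * Zᴴ)).trace -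
          (Z * τ * ((K i)ᴴ * Yᴴ * K i)).trace + (Z * τ * Zᴴ * ((K i)ᴴ * K i)).trace := by
      intro i
      have e2 : ((K i)ᴴ * Y * K i * (τ * Zᴴ)).trace = (Y * K i * τ * Zᴴ * (K i)ᴴ).trace := by
        rw [trace_mul_comm (Y * K i * τ * Zᴴ)]; simp only [Matrix.mul_assoc]
      have e3 : (Z * τ * ((K i)ᴴ * Yᴴ * K i)).trace = (K i * Z * τ * ((K i)ᴴ * Yᴴ)).trace := by
        rw [Matrix.mul_assoc (K i * Z), Matrix.mul_assoc (K i), trace_mul_comm (K i)]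
        simp only [Matrix.mul_assoc]
      have e4 : (Z * τ * Zᴴ * ((K i)ᴴ * K i)).trace = (K i * Z * τ * (Zᴴ * (K i)ᴴ)).trace := by
        rw [Matrix.mul_assoc (K i * Z), Matrix.mul_assoc (K i), trace_mul_comm (K i)]
        simp only [Matrix.mul_assoc]
      rw [e2, e3, e4]
      simp only [conjTranspose_sub, conjTranspose_mul, Matrix.sub_mul, Matrix.mul_sub, trace_sub,
        Matrix.mul_assoc]
      ring
    rw [trace_sum, Finset.sum_congr rfl fun i _ => e i]
    simp only [Finset.sum_add_distrib, Finset.sum_sub_distrib, ← trace_sum, ← Finset.sum_mul,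
      ← Finset.mul_sum]
    rw [hK, ← hZ, ← hZH, ← krausMap_apply, Matrix.mul_one, Matrix.mul_assoc Z]
    ring
  have h2 := (Complex.le_def.mp hpos.trace_nonneg).1
  rw [h1, Complex.sub_re, Complex.zero_re] at h2
  linarith

end Kraus

/-! ### Monotonicity of the relative entropy -/

section RelativeEntropy

variable {m n : Type*} [Fintype m] [DecidableEq m] [Fintype n] [DecidableEq n]

/-- The quadratic functional `2 Re Tr Yρ - s Tr YρYᴴ - Tr YᴴσY` of `Y`. Its maximum is the value at
`s` of the resolvent of the relative modular operator of `ρ` and `σ`. -/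
noncomputable def relQuad (s : ℝ) (ρ σ Y : Matrix m m ℂ) : ℝ :=
  2 * (Y * ρ).trace.re - s * (Y * ρ * Yᴴ).trace.re - (Yᴴ * σ * Y).trace.re

/-- The maximum of `relQuad s ρ σ`, in terms of the eigenvalues `p` of `ρ`, the eigenvalues `q`
of `σ`, and the matrix `V` of scalar products of the eigenvectors. -/
noncomputable def relResolvent (V : Matrix m m ℂ) (p q : m → ℝ) (s : ℝ) : ℝ :=
  ∑ i, ∑ j, ‖V j i‖ ^ 2 * (p i ^ 2 / (s * p i + q j))

/-- The primitive of `relResolvent` that vanishes at `0`. -/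
noncomputable def relPrimitive (V : Matrix m m ℂ) (p q : m → ℝ) (T : ℝ) : ℝ :=
  ∑ i, ∑ j, ‖V j i‖ ^ 2 * (p i * (log (T * p i + q j) - log (q j)))

theorem relQuad_eq {U W ρ σ : Matrix m m ℂ} {p q : m → ℝ} (hρ : Diagonalizes U p ρ)
    (hσ : Diagonalizes W q σ) (s : ℝ) (Z : Matrix m m ℂ) :
    relQuad s ρ σ (W * Z * Uᴴ) = ∑ i, ∑ j, (2 * (star ((Wᴴ * U) j i) * Z j i).re * p i -
      (s * p i + q j) * ‖Z j i‖ ^ 2) := by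
  have h1 : (W * Z * Uᴴ * ρ).trace = ∑ i, ∑ j, star ((Wᴴ * U) j i) * Z j i * p i := by
    calc _ = (W * Z * (Uᴴ * U) * diagonal (fun i => (p i : ℂ)) * Uᴴ).trace := by
          rw [hρ.eq]; simp only [Matrix.mul_assoc]
      _ = ((Wᴴ * U)ᴴ * Z * diagonal (fun i => (p i : ℂ))).trace := by
          rw [hρ.unitary, Matrix.mul_one, trace_mul_comm, conjTranspose_mul,
            conjTranspose_conjTranspose]
          simp only [Matrix.mul_assoc]
      _ = _ := by
          rw [Matrix.trace]
          refine Finset.sum_congr rfl fun i _ => ?_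
          rw [diag_apply, mul_diagonal, Matrix.mul_apply, Finset.sum_mul]
          rfl
  have h2 : (W * Z * Uᴴ * ρ * (W * Z * Uᴴ)ᴴ).trace =
      ((∑ i, ∑ j, p i * ‖Z j i‖ ^ 2 : ℝ) : ℂ) := by
    calc _ = (W * (Z * (Uᴴ * U) * diagonal (fun i => (p i : ℂ)) * (Uᴴ * U) * Zᴴ * Wᴴ)).trace := by
          rw [hρ.eq]
          simp only [conjTranspose_mul, conjTranspose_conjTranspose, Matrix.mul_assoc]
      _ = (Z * (diagonal (fun i => (p i : ℂ)) * Zᴴ)).trace := by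
          rw [hρ.unitary, trace_mul_comm, Matrix.mul_assoc _ Wᴴ, hσ.unitary]
          simp only [Matrix.mul_assoc, Matrix.mul_one]
      _ = (Zᴴ * Z * diagonal (fun i => (p i : ℂ))).trace := by
          rw [← Matrix.mul_assoc, trace_mul_comm, Matrix.mul_assoc]
      _ = _ := by
          rw [Matrix.trace]
          push_cast
          refine Finset.sum_congr rfl fun i _ => ?_
          rw [diag_apply, mul_diagonal, Matrix.mul_apply, Finset.sum_mul]
          refine Finset.sum_congr rfl fun j _ => ?_
          rw [conjTranspose_apply, ← Complex.conj_mul', starRingEnd_apply, mul_comm]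
  have h3 : ((W * Z * Uᴴ)ᴴ * σ * (W * Z * Uᴴ)).trace =
      ((∑ i, ∑ j, q j * ‖Z j i‖ ^ 2 : ℝ) : ℂ) := by
    calc _ = (U * (Zᴴ * (Wᴴ * W) * diagonal (fun i => (q i : ℂ)) * (Wᴴ * W) * Z * Uᴴ)).trace := by
          rw [hσ.eq]
          simp only [conjTranspose_mul, conjTranspose_conjTranspose, Matrix.mul_assoc]
      _ = (Zᴴ * (diagonal (fun i => (q i : ℂ)) * Z)).trace := by
          rw [hσ.unitary, trace_mul_comm, Matrix.mul_assoc _ Uᴴ, hρ.unitary]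
          simp only [Matrix.mul_assoc, Matrix.mul_one]
      _ = (Z * Zᴴ * diagonal (fun i => (q i : ℂ))).trace := by
          rw [← Matrix.mul_assoc, trace_mul_comm, Matrix.mul_assoc]
      _ = _ := by
          rw [Matrix.trace, Finset.sum_comm]
          push_cast
          refine Finset.sum_congr rfl fun j _ => ?_
          rw [diag_apply, mul_diagonal, Matrix.mul_apply, Finset.sum_mul]
          refine Finset.sum_congr rfl fun i _ => ?_
          rw [conjTranspose_apply, ← Complex.mul_conj', starRingEnd_apply, mul_comm]
  rw [relQuad, h1, h2, h3, Complex.ofReal_re, Complex.ofReal_re, Complex.re_sum]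
  simp only [Complex.re_sum, Complex.re_mul_ofReal, Finset.mul_sum, ← Finset.sum_sub_distrib]
  refine Finset.sum_congr rfl fun i _ => Finset.sum_congr rfl fun j _ => ?_
  ring

theorem relQuad_le {U W ρ σ : Matrix m m ℂ} {p q : m → ℝ} (hρ : Diagonalizes U p ρ)
    (hσ : Diagonalizes W q σ) (hp : ∀ i, 0 ≤ p i) (hq : ∀ j, 0 < q j) {s : ℝ} (hs : 0 ≤ s)
    (Y : Matrix m m ℂ) : relQuad s ρ σ Y ≤ relResolvent (Wᴴ * U) p q s := by
  have hY : Y = W * (Wᴴ * Y * U) * Uᴴ := by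
    rw [← Matrix.mul_assoc, ← Matrix.mul_assoc, hσ.unitary', Matrix.one_mul, Matrix.mul_assoc,
      hρ.unitary', Matrix.mul_one]
  rw [hY, relQuad_eq hρ hσ, relResolvent]
  refine Finset.sum_le_sum fun i _ => Finset.sum_le_sum fun j _ => ?_
  set v := (Wᴴ * U) j i
  set z := (Wᴴ * Y * U) j i
  have hc : 0 < s * p i + q j := by have := hp i; have := hq j; positivity
  have h1 : (star v * z).re ≤ ‖v‖ * ‖z‖ := by
    refine (Complex.re_le_norm _).trans_eq ?_
    rw [norm_mul, norm_star]
  have h2 : (star v * z).re * p i ≤ ‖v‖ * ‖z‖ * p i := mul_le_mul_of_nonneg_right h1 (hp i)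
  have h3 : ‖v‖ ^ 2 * (p i ^ 2 / (s * p i + q j)) - (2 * (‖v‖ * ‖z‖ * p i) -
      (s * p i + q j) * ‖z‖ ^ 2) =
      ((s * p i + q j) * ‖z‖ - ‖v‖ * p i) ^ 2 / (s * p i + q j) := by
    generalize s * p i + q j = c at hc
    field_simp
    ring
  have h4 : 0 ≤ ((s * p i + q j) * ‖z‖ - ‖v‖ * p i) ^ 2 / (s * p i + q j) := by positivity
  linarith

theorem exists_relQuad_eq {U W ρ σ : Matrix m m ℂ} {p q : m → ℝ} (hρ : Diagonalizes U p ρ)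
    (hσ : Diagonalizes W q σ) (hp : ∀ i, 0 ≤ p i) (hq : ∀ j, 0 < q j) {s : ℝ} (hs : 0 ≤ s) :
    ∃ Y, relQuad s ρ σ Y = relResolvent (Wᴴ * U) p q s := by
  refine ⟨W * (Matrix.of fun j i => ((p i / (s * p i + q j) : ℝ) : ℂ) * (Wᴴ * U) j i) * Uᴴ, ?_⟩
  rw [relQuad_eq hρ hσ, relResolvent]
  refine Finset.sum_congr rfl fun i _ => Finset.sum_congr rfl fun j _ => ?_
  rw [of_apply]
  set v := (Wᴴ * U) j i
  have hc : 0 < s * p i + q j := by have := hp i; have := hq j; positivity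
  have h1 : star v * (((p i / (s * p i + q j) : ℝ) : ℂ) * v) =
      ((p i / (s * p i + q j) * ‖v‖ ^ 2 : ℝ) : ℂ) := by
    rw [mul_left_comm, ← starRingEnd_apply, Complex.conj_mul']; push_cast; ring
  rw [h1, Complex.ofReal_re, norm_mul, Complex.norm_real, Real.norm_eq_abs, mul_pow, sq_abs]
  field_simp
  ring

/-- By the Kadison–Schwarz inequality, a quantum operation can only decrease the maximum of
`relQuad`. -/
theorem relResolvent_krausMap_le {ι : Type*} [Fintype ι] {K : ι → Matrix n m ℂ}
    (hK : ∑ i, (K i)ᴴ * K i = 1) {U W ρ σ : Matrix m m ℂ} {p q : m → ℝ}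
    {U' W' σ' : Matrix n n ℂ} {p' q' : n → ℝ} (hρp : ρ.PosSemidef) (hρ : Diagonalizes U p ρ)
    (hσ : Diagonalizes W q σ) (hq : ∀ j, 0 < q j) (hρ' : Diagonalizes U' p' (krausMap K ρ))
    (hσ' : Diagonalizes W' q' σ') (hq' : ∀ j, 0 < q' j) (hle : (σ' - krausMap K σ).PosSemidef)
    {s : ℝ} (hs : 0 ≤ s) :
    relResolvent (W'ᴴ * U') p' q' s ≤ relResolvent (Wᴴ * U) p q s := by
  obtain ⟨Y, hY⟩ := exists_relQuad_eq hρ' hσ' (hρ'.nonneg (posSemidef_krausMap K hρp)) hq' hs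
  set Z := ∑ i, (K i)ᴴ * Y * K i with hZ
  refine le_trans ?_ (relQuad_le hρ hσ (hρ.nonneg hρp) hq hs Z)
  have hZH : Zᴴ = ∑ i, (K i)ᴴ * Yᴴ * K i := by
    rw [hZ, conjTranspose_sum]
    simp [conjTranspose_mul, Matrix.mul_assoc]
  have h1 : (Y * krausMap K ρ).trace = (Z * ρ).trace := by
    rw [krausMap_apply, Finset.mul_sum, trace_sum, hZ, Finset.sum_mul, trace_sum]
    refine Finset.sum_congr rfl fun i _ => ?_
    rw [← Matrix.mul_assoc, trace_mul_comm]
    simp only [Matrix.mul_assoc]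
  have h2 := trace_kadison_schwarz hK hρp Y
  have h3 := trace_kadison_schwarz hK (hσ.posSemidef fun j => (hq j).le) Yᴴ
  have h4 := (Complex.le_def.mp (hle.conjTranspose_mul_mul_same Y).trace_nonneg).1
  rw [← hZH, conjTranspose_conjTranspose, conjTranspose_conjTranspose] at h3
  rw [Matrix.mul_sub, Matrix.sub_mul, trace_sub, Complex.sub_re, Complex.zero_re] at h4
  rw [← hY, relQuad, relQuad, h1]
  have h5 := mul_le_mul_of_nonneg_left h2 hs
  linarith

omit [DecidableEq m] in
theorem hasDerivAt_relPrimitive (V : Matrix m m ℂ) {p q : m → ℝ} (hp : ∀ i, 0 ≤ p i)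
    (hq : ∀ j, 0 < q j) {T : ℝ} (hT : 0 ≤ T) :
    HasDerivAt (relPrimitive V p q) (relResolvent V p q T) T := by
  unfold relPrimitive relResolvent
  refine HasDerivAt.fun_sum fun i _ => HasDerivAt.fun_sum fun j _ => HasDerivAt.const_mul _ ?_
  have hc : T * p i + q j ≠ 0 := by
    have := hp i; have := hq j; positivity
  have h1 : HasDerivAt (fun T : ℝ => T * p i + q j) (p i) T := by
    simpa using ((hasDerivAt_id T).mul_const (p i)).add_const (q j)
  convert ((h1.log hc).sub_const (log (q j))).const_mul (p i) using 1
  ring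

omit [DecidableEq m] in
theorem relPrimitive_zero (V : Matrix m m ℂ) (p q : m → ℝ) : relPrimitive V p q 0 = 0 := by
  simp [relPrimitive]

theorem tendsto_relPrimitive {V : Matrix m m ℂ} (hV : Vᴴ * V = 1) {p q : m → ℝ}
    (hp : ∀ i, 0 ≤ p i) (hq : ∀ j, 0 < q j) :
    Tendsto (fun T => relPrimitive V p q T - log T * ∑ i, p i) atTop
      (𝓝 (-∑ i, negMulLog (p i) - ∑ j, (∑ i, ‖V j i‖ ^ 2 * p i) * log (q j))) := by
  have hlim : -∑ i, negMulLog (p i) - ∑ j, (∑ i, ‖V j i‖ ^ 2 * p i) * log (q j) =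
      ∑ i, ∑ j, ‖V j i‖ ^ 2 * (p i * log (p i) - p i * log (q j)) := by
    have h1 : -∑ i, negMulLog (p i) = ∑ i, ∑ j, ‖V j i‖ ^ 2 * (p i * log (p i)) := by
      rw [← Finset.sum_neg_distrib]
      refine Finset.sum_congr rfl fun i _ => ?_
      rw [← Finset.sum_mul, sum_normSq_col hV, negMulLog]; ring
    have h2 : ∑ j, (∑ i, ‖V j i‖ ^ 2 * p i) * log (q j) =
        ∑ i, ∑ j, ‖V j i‖ ^ 2 * (p i * log (q j)) := by
      simp only [Finset.sum_mul]
      rw [Finset.sum_comm]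
      simp only [mul_assoc]
    rw [h1, h2]
    simp only [← Finset.sum_sub_distrib, mul_sub]
  rw [hlim]
  have hev : (fun T => relPrimitive V p q T - log T * ∑ i, p i) =ᶠ[atTop] fun T =>
      ∑ i, ∑ j, ‖V j i‖ ^ 2 * (p i * log (p i + q j / T) - p i * log (q j)) := by
    filter_upwards [eventually_gt_atTop 0] with T hT
    have h1 : log T * ∑ i, p i = ∑ i, ∑ j, ‖V j i‖ ^ 2 * (p i * log T) := by
      rw [Finset.mul_sum]
      refine Finset.sum_congr rfl fun i _ => ?_
      rw [← Finset.sum_mul, sum_normSq_col hV]; ring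
    rw [h1, relPrimitive, ← Finset.sum_sub_distrib]
    refine Finset.sum_congr rfl fun i _ => ?_
    rw [← Finset.sum_sub_distrib]
    refine Finset.sum_congr rfl fun j _ => ?_
    have h0 : 0 < p i + q j / T := by have := hp i; have := hq j; positivity
    have h2 : T * p i + q j = T * (p i + q j / T) := by field_simp
    rw [h2, Real.log_mul hT.ne' h0.ne']
    ring
  refine Tendsto.congr' hev.symm ?_
  refine tendsto_finsetSum _ fun i _ => tendsto_finsetSum _ fun j _ => ?_
  refine (Tendsto.sub_const ?_ _).const_mul _
  rcases (hp i).eq_or_lt with h0 | h0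
  · simp [← h0]
  · refine Tendsto.const_mul _ ?_
    refine Tendsto.log ?_ h0.ne'
    have : Tendsto (fun T : ℝ => q j / T) atTop (𝓝 0) := tendsto_const_nhds.div_atTop tendsto_id
    simpa using this.const_add (p i)

/-- Monotonicity of the relative entropy `Tr ρ log ρ - Tr ρ log σ` under quantum operations, for
positive definite `σ`. The second argument may moreover be increased on the output side. -/
theorem relativeEntropy_krausMap_le {ι : Type*} [Fintype ι] {K : ι → Matrix n m ℂ}
    (hK : ∑ i, (K i)ᴴ * K i = 1) {W ρ σ : Matrix m m ℂ} {q : m → ℝ}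
    {W' σ' : Matrix n n ℂ} {q' : n → ℝ} (hρ : ρ.PosSemidef)
    (hσ : Diagonalizes W q σ) (hq : ∀ j, 0 < q j)
    (hσ' : Diagonalizes W' q' σ') (hq' : ∀ j, 0 < q' j) (hle : (σ' - krausMap K σ).PosSemidef) :
    -natEntropy (krausMap K ρ) - ∑ j, ((W'ᴴ * krausMap K ρ * W') j j).re * log (q' j) ≤
      -natEntropy ρ - ∑ j, ((Wᴴ * ρ * W) j j).re * log (q j) := by
  obtain ⟨U, p, h⟩ : ∃ U p, Diagonalizes U p ρ := ⟨_, _, hρ.isHermitian.diagonalizes⟩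
  have hρ' := posSemidef_krausMap K hρ
  obtain ⟨U', p', h'⟩ : ∃ U p, Diagonalizes U p (krausMap K ρ) :=
    ⟨_, _, hρ'.isHermitian.diagonalizes⟩
  have hV : (Wᴴ * U)ᴴ * (Wᴴ * U) = 1 := by
    rw [conjTranspose_mul, conjTranspose_conjTranspose, Matrix.mul_assoc, ← Matrix.mul_assoc W,
      hσ.unitary', Matrix.one_mul, h.unitary]
  have hV' : (W'ᴴ * U')ᴴ * (W'ᴴ * U') = 1 := by
    rw [conjTranspose_mul, conjTranspose_conjTranspose, Matrix.mul_assoc, ← Matrix.mul_assoc W',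
      hσ'.unitary', Matrix.one_mul, h'.unitary]
  have hp := h.nonneg hρ
  have hp' := h'.nonneg hρ'
  have htr : ∑ i, p' i = ∑ i, p i := by
    have := trace_krausMap K hK ρ
    rw [h.trace, h'.trace] at this
    exact_mod_cast this
  have hmono : MonotoneOn (fun T => relPrimitive (Wᴴ * U) p q T - relPrimitive (W'ᴴ * U') p' q' T)
      (Set.Ici 0) := by
    have hd : ∀ T : ℝ, 0 ≤ T → HasDerivAt
        (fun T => relPrimitive (Wᴴ * U) p q T - relPrimitive (W'ᴴ * U') p' q' T)
        (relResolvent (Wᴴ * U) p q T - relResolvent (W'ᴴ * U') p' q' T) T := fun T hT =>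
      (hasDerivAt_relPrimitive _ hp hq hT).sub (hasDerivAt_relPrimitive _ hp' hq' hT)
    refine monotoneOn_of_deriv_nonneg (convex_Ici 0)
      (fun T hT => (hd T hT).continuousAt.continuousWithinAt) (fun T hT => ?_) fun T hT => ?_
    · rw [interior_Ici] at hT
      exact (hd T (le_of_lt hT)).differentiableAt.differentiableWithinAt
    · rw [interior_Ici] at hT
      rw [(hd T (le_of_lt hT)).deriv, sub_nonneg]
      exact relResolvent_krausMap_le hK hρ h hσ hq h' hσ' hq' hle (le_of_lt hT)
  have hlim := tendsto_relPrimitive hV hp hq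
  have hlim' := tendsto_relPrimitive hV' hp' hq'
  have hfin := le_of_tendsto_of_tendsto hlim' hlim (by
    filter_upwards [eventually_ge_atTop 0] with T hT
    have := hmono (Set.mem_Ici.mpr le_rfl) (Set.mem_Ici.mpr hT) hT
    simp only [relPrimitive_zero, sub_zero] at this
    rw [htr]
    linarith)
  rw [h.natEntropy_eq, h'.natEntropy_eq]
  simpa only [h.conj_apply_self, h'.conj_apply_self, Complex.ofReal_re] using hfin

end RelativeEntropy

/-! ### Data processing for the conditional entropy -/

section DataProcessing

variable {k m n : Type*} [Fintype k] [DecidableEq k] [Fintype m] [DecidableEq m] [Fintype n]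
  [DecidableEq n]

omit [DecidableEq k] [Fintype m] [DecidableEq m] [Fintype n] [DecidableEq n] in
theorem traceFst_idTensor (Φ : Matrix m m ℂ →ₗ[ℂ] Matrix n n ℂ) (X : Matrix (k × m) (k × m) ℂ) :
    traceFst (idTensor k Φ X) = Φ (traceFst X) := by
  have : traceFst X = ∑ i, Matrix.of fun a b => X (i, a) (i, b) := by
    ext a b; simp [traceFst, Matrix.sum_apply]
  rw [this, map_sum]
  ext a b
  simp [traceFst, Matrix.sum_apply, idTensor_apply]

omit [Fintype k] [Fintype m] [DecidableEq m] [Fintype n] [DecidableEq n] in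
theorem idTensor_one_kronecker (Φ : Matrix m m ℂ →ₗ[ℂ] Matrix n n ℂ) (X : Matrix m m ℂ) :
    idTensor k Φ ((1 : Matrix k k ℂ) ⊗ₖ X) = (1 : Matrix k k ℂ) ⊗ₖ Φ X := by
  ext ⟨c, a⟩ ⟨d, b⟩
  have : (Matrix.of fun i j => ((1 : Matrix k k ℂ) ⊗ₖ X) (c, i) (d, j)) =
      (1 : Matrix k k ℂ) c d • X := by
    ext i j; simp
  rw [idTensor_apply, this, map_smul]; simp

omit [DecidableEq m] in
theorem one_kronecker_conj_diag (X : Matrix (k × m) (k × m) ℂ) (U : Matrix m m ℂ) (b : m) :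
    ∑ a, (((1 : Matrix k k ℂ) ⊗ₖ U)ᴴ * X * ((1 : Matrix k k ℂ) ⊗ₖ U)) (a, b) (a, b) =
      (Uᴴ * traceFst X * U) b b := by
  have h1 : ((1 : Matrix k k ℂ) ⊗ₖ U)ᴴ * X * ((1 : Matrix k k ℂ) ⊗ₖ U) =
      idTensor k (krausMap fun _ : Unit => Uᴴ) X := by
    rw [idTensor_krausMap, krausMap_apply]
    simp [conjTranspose_kronecker]
  have h2 := congrFun (congrFun (traceFst_idTensor (krausMap fun _ : Unit => Uᴴ) X) b) b
  rw [← h1] at h2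
  refine h2.trans ?_
  simp [krausMap_apply]

omit [DecidableEq k] [Fintype m] [DecidableEq m] in
theorem posSemidef_traceFst {X : Matrix (k × m) (k × m) ℂ} (hX : X.PosSemidef) :
    (traceFst X).PosSemidef := by
  have : traceFst X = ∑ i, X.submatrix (fun a => (i, a)) (fun a => (i, a)) := by
    ext a b; simp [traceFst, Matrix.sum_apply]
  rw [this]
  exact posSemidef_sum _ fun i _ => hX.submatrix _

/-- Klein's inequality `Tr X log Y ≤ Tr X log X + Tr Y - Tr X`, with the left-hand side computed in
an eigenbasis of `Y`. -/
theorem sum_diag_mul_log_le {X Y U : Matrix m m ℂ} {t : m → ℝ} (hX : X.PosSemidef)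
    (hY : Diagonalizes U t Y) (ht : ∀ i, 0 < t i) :
    ∑ i, ((Uᴴ * X * U) i i).re * log (t i) ≤ -natEntropy X + (Y.trace.re - X.trace.re) := by
  have h1 := natEntropy_le_sum_diag hX hY.unitary
  have h2 : X.trace.re = ∑ i, ((Uᴴ * X * U) i i).re := by
    rw [← Complex.re_sum]
    change _ = (Matrix.trace (Uᴴ * X * U)).re
    rw [trace_mul_cycle, hY.unitary', Matrix.one_mul]
  have h3 : ∀ i, ((Uᴴ * X * U) i i).re * log (t i) ≤
      -negMulLog ((Uᴴ * X * U) i i).re + (t i - ((Uᴴ * X * U) i i).re) := by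
    intro i
    have hr := (Complex.le_def.mp ((hX.conjTranspose_mul_mul_same U).diag_nonneg (i := i))).1
    rw [Complex.zero_re] at hr
    set r := ((Uᴴ * X * U) i i).re
    rcases hr.eq_or_lt with h0 | h0
    · rw [← h0]; simpa using (ht i).le
    · have := Real.log_le_sub_one_of_pos (x := t i / r) (div_pos (ht i) h0)
      rw [Real.log_div (ht i).ne' h0.ne'] at this
      have h4 : r * (log (t i) - log r) ≤ r * (t i / r - 1) := mul_le_mul_of_nonneg_left this hr
      have h5 : r * (t i / r - 1) = t i - r := by field_simp
      rw [negMulLog]; linarith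
  have h4 := Finset.sum_le_sum fun i (_ : i ∈ Finset.univ) => h3 i
  rw [Finset.sum_add_distrib, Finset.sum_sub_distrib, Finset.sum_neg_distrib, ← h2] at h4
  rw [hY.trace, Complex.ofReal_re]
  linarith

/-- Data processing: the conditional entropy of `k` given `m` does not decrease under a quantum
operation on `m`. This is monotonicity of the relative entropy with respect to `1 ⊗ (X^m + η)`,
in the limit `η → 0`. -/
theorem condEntropy_le_idTensor {Φ : Matrix m m ℂ →ₗ[ℂ] Matrix n n ℂ} (hΦ : IsQuantumOperation Φ)
    {X : Matrix (k × m) (k × m) ℂ} (hX : X.PosSemidef) :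
    natEntropy X - natEntropy (traceFst X) ≤
      natEntropy (idTensor k Φ X) - natEntropy (traceFst (idTensor k Φ X)) := by
  obtain ⟨r, K, rfl, hK⟩ := hΦ.exists_kraus
  have hXm := posSemidef_traceFst hX
  obtain ⟨U, q, h⟩ : ∃ U q, Diagonalizes U q (traceFst X) := ⟨_, _, hXm.isHermitian.diagonalizes⟩
  have hq := h.nonneg hXm
  have hY : (krausMap K (traceFst X)).PosSemidef := posSemidef_krausMap K hXm
  have key : ∀ η : ℝ, 0 < η → natEntropy X + ∑ b, q b * log (q b + η) ≤
      natEntropy (idTensor k (krausMap K) X) - natEntropy (krausMap K (traceFst X)) +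
        η * (Fintype.card m + Fintype.card n) := by
    intro η hη
    have hσ := h.add_smul_one η
    have hpos : (krausMap K (traceFst X + (η : ℂ) • 1)).PosSemidef :=
      posSemidef_krausMap K (hσ.posSemidef fun i => add_nonneg (hq i) hη.le)
    obtain ⟨U', t, h'⟩ : ∃ U q, Diagonalizes U q (krausMap K (traceFst X + (η : ℂ) • 1)) :=
      ⟨_, _, hpos.isHermitian.diagonalizes⟩
    have ht := h'.nonneg hpos
    have hσ' := h'.add_smul_one η
    have hle : ((1 : Matrix k k ℂ) ⊗ₖ (krausMap K (traceFst X + (η : ℂ) • 1) + (η : ℂ) • 1) -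
        krausMap (fun i => (1 : Matrix k k ℂ) ⊗ₖ K i)
          ((1 : Matrix k k ℂ) ⊗ₖ (traceFst X + (η : ℂ) • 1))).PosSemidef := by
      rw [← idTensor_krausMap, idTensor_one_kronecker, kronecker_add, add_sub_cancel_left,
        kronecker_smul, one_kronecker_one]
      exact PosSemidef.one.smul (by exact_mod_cast hη.le)
    have hmono := relativeEntropy_krausMap_le (sum_conjTranspose_mul_one_kronecker (k := k) hK) hX
      (hσ.one_kronecker (n := k)) (fun j => add_pos_of_nonneg_of_pos (hq _) hη)
      (hσ'.one_kronecker (n := k)) (fun j => add_pos_of_nonneg_of_pos (ht _) hη) hle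
    rw [← idTensor_krausMap] at hmono
    simp only [Fintype.sum_prod_type_right, ← Finset.sum_mul, ← Complex.re_sum,
      one_kronecker_conj_diag, traceFst_idTensor, h.eigenvalue_eq] at hmono
    have hklein := sum_diag_mul_log_le hY hσ' fun j => add_pos_of_nonneg_of_pos (ht _) hη
    have htr : (krausMap K (traceFst X + (η : ℂ) • 1) + (η : ℂ) • 1).trace.re -
        (krausMap K (traceFst X)).trace.re = η * (Fintype.card m + Fintype.card n) := by
      rw [trace_add, trace_krausMap K hK, trace_krausMap K hK, trace_add, trace_smul, trace_smul,
        trace_one, trace_one]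
      simp
      ring
    rw [htr] at hklein
    linarith
  have hlim1 : Tendsto (fun η : ℝ => natEntropy X + ∑ b, q b * log (q b + η)) (𝓝[>] 0)
      (𝓝 (natEntropy X + ∑ b, q b * log (q b))) := by
    refine Tendsto.const_add _ (tendsto_finsetSum _ fun b _ => ?_)
    rcases (hq b).eq_or_lt with h0 | h0
    · simp [← h0]
    · refine Tendsto.const_mul _ (Tendsto.log ?_ h0.ne')
      have : Tendsto (fun η : ℝ => η) (𝓝[>] 0) (𝓝 0) := tendsto_id.mono_left nhdsWithin_le_nhds
      simpa using this.const_add (q b)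
  have hlim2 : Tendsto (fun η : ℝ => natEntropy (idTensor k (krausMap K) X) -
      natEntropy (krausMap K (traceFst X)) + η * (Fintype.card m + Fintype.card n)) (𝓝[>] 0)
      (𝓝 (natEntropy (idTensor k (krausMap K) X) - natEntropy (krausMap K (traceFst X)))) := by
    have : Tendsto (fun η : ℝ => η) (𝓝[>] 0) (𝓝 0) := tendsto_id.mono_left nhdsWithin_le_nhds
    simpa using (this.mul_const ((Fintype.card m : ℝ) + Fintype.card n)).const_add
      (natEntropy (idTensor k (krausMap K) X) - natEntropy (krausMap K (traceFst X)))
  have hfin := le_of_tendsto_of_tendsto hlim1 hlim2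
    (by filter_upwards [self_mem_nhdsWithin] with η hη using key η hη)
  have hent : natEntropy (traceFst X) = -∑ b, q b * log (q b) := by
    rw [h.natEntropy_eq, ← Finset.sum_neg_distrib]
    exact Finset.sum_congr rfl fun b _ => by rw [negMulLog]; ring
  rw [traceFst_idTensor, hent]
  linarith

end DataProcessing

/-! ### Tensor powers -/

section TensorPower

variable {m : Type*} [Fintype m] [DecidableEq m]

/-- The `n`-fold tensor power of a matrix. -/
def piPower (M : Matrix m m ℂ) (n : ℕ) : Matrix (Fin n → m) (Fin n → m) ℂ :=
  Matrix.of fun x y => ∏ j, M (x j) (y j)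

omit [DecidableEq m] in
theorem piPower_mul (M N : Matrix m m ℂ) (n : ℕ) :
    piPower (M * N) n = piPower M n * piPower N n := by
  ext x y
  simp only [piPower, of_apply, Matrix.mul_apply, Finset.prod_univ_sum, Fintype.piFinset_univ,
    Finset.prod_mul_distrib]

omit [Fintype m] [DecidableEq m] in
theorem piPower_conjTranspose (M : Matrix m m ℂ) (n : ℕ) : piPower Mᴴ n = (piPower M n)ᴴ := by
  ext x y
  simp [piPower]

omit [Fintype m] in
theorem piPower_diagonal (d : m → ℂ) (n : ℕ) :
    piPower (diagonal d) n = diagonal fun x => ∏ j, d (x j) := by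
  ext x y
  by_cases h : x = y
  · subst h; simp [piPower]
  · obtain ⟨j, hj⟩ := Function.ne_iff.mp h
    rw [diagonal_apply_ne _ h]
    exact Finset.prod_eq_zero (Finset.mem_univ j) (diagonal_apply_ne _ hj)

theorem Diagonalizes.piPower {U X : Matrix m m ℂ} {d : m → ℝ} (h : Diagonalizes U d X) (n : ℕ) :
    Diagonalizes (piPower U n) (fun x => ∏ j, d (x j)) (piPower X n) where
  unitary := by
    rw [← piPower_conjTranspose, ← piPower_mul, h.unitary, ← diagonal_one, piPower_diagonal]
    simp
  eq := by
    have : (diagonal fun x : Fin n → m => ((∏ j, d (x j) : ℝ) : ℂ)) =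
        Markovianization.piPower (diagonal fun i => (d i : ℂ)) n := by
      rw [piPower_diagonal]; push_cast; rfl
    rw [this, ← piPower_conjTranspose, ← piPower_mul, ← piPower_mul, ← h.eq]

theorem negMulLog_prod {ι : Type*} [DecidableEq ι] (s : Finset ι) (a : ι → ℝ) :
    negMulLog (∏ j ∈ s, a j) = ∑ i ∈ s, ∏ j ∈ s, if j = i then negMulLog (a j) else a j := by
  induction s using Finset.induction_on with
  | empty => simp
  | insert b s hb ih =>
    rw [Finset.prod_insert hb, negMulLog_mul, ih, Finset.sum_insert hb, Finset.prod_insert hb,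
      if_pos rfl, mul_comm (negMulLog (a b)), Finset.mul_sum]
    congr 1
    · congr 1
      exact Finset.prod_congr rfl fun j hj => (if_neg fun h : j = b => hb (h ▸ hj)).symm
    · refine Finset.sum_congr rfl fun i hi => ?_
      rw [Finset.prod_insert hb, if_neg fun h : b = i => hb (h ▸ hi)]

/-- The entropy of a state is additive under tensor powers. -/
theorem natEntropy_piPower {X : Matrix m m ℂ} (hX : X.IsHermitian) (h1 : X.trace = 1) (n : ℕ) :
    natEntropy (piPower X n) = n * natEntropy X := by
  have h := hX.diagonalizes
  have hd : ∑ i, hX.eigenvalues i = 1 := by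
    have := h.trace; rw [h1] at this; exact_mod_cast this.symm
  rw [(h.piPower n).natEntropy_eq, h.natEntropy_eq]
  simp only [negMulLog_prod]
  rw [Finset.sum_comm]
  have : ∀ i : Fin n, ∑ x : Fin n → m, ∏ j, (if j = i then negMulLog (hX.eigenvalues (x j))
      else hX.eigenvalues (x j)) = ∑ a, negMulLog (hX.eigenvalues a) := by
    intro i
    have h2 := Finset.prod_univ_sum (fun _ : Fin n => (Finset.univ : Finset m))
      (fun j a => if j = i then negMulLog (hX.eigenvalues a) else hX.eigenvalues a)
    rw [Fintype.piFinset_univ] at h2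
    rw [← h2, Finset.prod_eq_single i]
    · simp
    · intro j _ hj; simp [hj, hd]
    · simp
  simp [this]

end TensorPower

/-! ### Marginals -/

section Marginals

variable {A B C : Type*} [Fintype A] [Fintype B] [Fintype C]

omit [Fintype B] [Fintype C] in
theorem marginalBC_apply (X : Matrix (A × B × C) (A × B × C) ℂ) (p q : B × C) :
    marginalBC X p q = ∑ a, X (a, p) (a, q) := rfl

omit [Fintype A] [Fintype B] in
theorem marginalAB_apply (X : Matrix (A × B × C) (A × B × C) ℂ) (p q : A × B) :
    marginalAB X p q = ∑ c, X (p.1, p.2, c) (q.1, q.2, c) := rfl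

omit [Fintype B] in
theorem marginalB_apply (X : Matrix (A × B × C) (A × B × C) ℂ) (b b' : B) :
    marginalB X b b' = ∑ a, ∑ c, X (a, b, c) (a, b', c) := rfl

omit [Fintype B] in
theorem traceSnd_marginalBC (X : Matrix (A × B × C) (A × B × C) ℂ) :
    traceSnd (marginalBC X) = marginalB X := by
  ext b b'
  rw [marginalB_apply, Finset.sum_comm]
  rfl

theorem trace_traceFst {m m' : Type*} [Fintype m] [Fintype m'] (X : Matrix (m × m') (m × m') ℂ) :
    (traceFst X).trace = X.trace := by
  simp only [Matrix.trace, diag_apply, traceFst]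
  rw [Finset.sum_comm, Fintype.sum_prod_type]

theorem trace_marginalBC (X : Matrix (A × B × C) (A × B × C) ℂ) :
    (marginalBC X).trace = X.trace := trace_traceFst X

theorem trace_marginalAB (X : Matrix (A × B × C) (A × B × C) ℂ) :
    (marginalAB X).trace = X.trace := by
  simp only [Matrix.trace, diag_apply, marginalAB_apply, Fintype.sum_prod_type]

theorem trace_marginalB (X : Matrix (A × B × C) (A × B × C) ℂ) :
    (marginalB X).trace = X.trace := (trace_traceFst _).trans (trace_marginalAB X)

omit [Fintype B] [Fintype C] in
theorem _root_.Matrix.PosSemidef.marginalBC {X : Matrix (A × B × C) (A × B × C) ℂ}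
    (hX : X.PosSemidef) : (marginalBC X).PosSemidef := posSemidef_traceFst hX

omit [Fintype A] [Fintype B] in
theorem _root_.Matrix.PosSemidef.marginalAB {X : Matrix (A × B × C) (A × B × C) ℂ}
    (hX : X.PosSemidef) : (marginalAB X).PosSemidef := by
  have : Markovianization.marginalAB X = ∑ c, X.submatrix (fun p : A × B => (p.1, p.2, c))
      (fun p : A × B => (p.1, p.2, c)) := by
    ext p q; simp [marginalAB_apply, Matrix.sum_apply]
  rw [this]
  exact posSemidef_sum _ fun i _ => hX.submatrix _

omit [Fintype B] in
theorem _root_.Matrix.PosSemidef.marginalB {X : Matrix (A × B × C) (A × B × C) ℂ}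
    (hX : X.PosSemidef) : (marginalB X).PosSemidef := posSemidef_traceFst hX.marginalAB

omit [Fintype B] [Fintype C] in
theorem marginalBC_add (X Y : Matrix (A × B × C) (A × B × C) ℂ) :
    marginalBC (X + Y) = marginalBC X + marginalBC Y := by
  ext p q; simp [marginalBC_apply, Finset.sum_add_distrib]

omit [Fintype A] [Fintype B] in
theorem marginalAB_add (X Y : Matrix (A × B × C) (A × B × C) ℂ) :
    marginalAB (X + Y) = marginalAB X + marginalAB Y := by
  ext p q; simp [marginalAB_apply, Finset.sum_add_distrib]

omit [Fintype A] [Fintype B] [Fintype C] in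
theorem tensorPower_eq (ρ : Matrix (A × B × C) (A × B × C) ℂ) (n : ℕ) :
    tensorPower ρ n = (piPower ρ n).submatrix
      (((Equiv.refl _).prodCongr (Equiv.arrowProdEquivProdArrow (Fin n) (fun _ => B)
        fun _ => C).symm).trans
        (Equiv.arrowProdEquivProdArrow (Fin n) (fun _ => A) fun _ => B × C).symm)
      (((Equiv.refl _).prodCongr (Equiv.arrowProdEquivProdArrow (Fin n) (fun _ => B)
        fun _ => C).symm).trans
        (Equiv.arrowProdEquivProdArrow (Fin n) (fun _ => A) fun _ => B × C).symm) := rfl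

omit [Fintype B] [Fintype C] in
theorem marginalBC_tensorPower (ρ : Matrix (A × B × C) (A × B × C) ℂ) (n : ℕ) :
    marginalBC (tensorPower ρ n) = (piPower (marginalBC ρ) n).submatrix
      (Equiv.arrowProdEquivProdArrow (Fin n) (fun _ => B) fun _ => C).symm
      (Equiv.arrowProdEquivProdArrow (Fin n) (fun _ => B) fun _ => C).symm := by
  ext p q
  have := Finset.prod_univ_sum (fun _ : Fin n => (Finset.univ : Finset A))
      (fun j a => ρ (a, p.1 j, p.2 j) (a, q.1 j, q.2 j))
  rw [Fintype.piFinset_univ] at this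
  exact this.symm

omit [Fintype A] [Fintype B] in
theorem marginalAB_tensorPower (ρ : Matrix (A × B × C) (A × B × C) ℂ) (n : ℕ) :
    marginalAB (tensorPower ρ n) = (piPower (marginalAB ρ) n).submatrix
      (Equiv.arrowProdEquivProdArrow (Fin n) (fun _ => A) fun _ => B).symm
      (Equiv.arrowProdEquivProdArrow (Fin n) (fun _ => A) fun _ => B).symm := by
  ext p q
  have := Finset.prod_univ_sum (fun _ : Fin n => (Finset.univ : Finset C))
      (fun j c => ρ (p.1 j, p.2 j, c) (q.1 j, q.2 j, c))
  rw [Fintype.piFinset_univ] at this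
  exact this.symm

omit [Fintype B] in
theorem marginalB_tensorPower (ρ : Matrix (A × B × C) (A × B × C) ℂ) (n : ℕ) :
    marginalB (tensorPower ρ n) = piPower (marginalB ρ) n := by
  ext b b'
  have := Finset.prod_univ_sum (fun _ : Fin n => (Finset.univ : Finset A))
      (fun j a => marginalAB ρ (a, b j) (a, b' j))
  rw [Fintype.piFinset_univ] at this
  change traceFst (marginalAB (tensorPower ρ n)) b b' = _
  rw [marginalAB_tensorPower]
  exact this.symm

variable [DecidableEq A] [DecidableEq B] [DecidableEq C]

theorem isState_tensorPower {ρ : Matrix (A × B × C) (A × B × C) ℂ} (hρ : IsState ρ) (n : ℕ) :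
    IsState (tensorPower ρ n) := by
  have h := hρ.1.isHermitian.diagonalizes
  constructor
  · rw [tensorPower_eq]
    exact ((h.piPower n).posSemidef fun x =>
      Finset.prod_nonneg fun j _ => h.nonneg hρ.1 _).submatrix _
  · rw [← trace_marginalB, marginalB_tensorPower, Matrix.trace]
    have := Finset.prod_univ_sum (fun _ : Fin n => (Finset.univ : Finset B))
      (fun _ b => marginalB ρ b b)
    rw [Fintype.piFinset_univ] at this
    refine this.symm.trans ?_
    refine Finset.prod_eq_one fun j _ => ?_
    exact (trace_marginalB ρ).trans hρ.2

/-- The conditional mutual information in natural units. -/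
noncomputable def natCondMutualInfo (ρ : Matrix (A × B × C) (A × B × C) ℂ) : ℝ :=
  natEntropy (marginalAB ρ) + natEntropy (marginalBC ρ) - natEntropy (marginalB ρ) - natEntropy ρ

theorem natCondMutualInfo_eq (ρ : Matrix (A × B × C) (A × B × C) ℂ) :
    natCondMutualInfo ρ = condMutualInfo ρ * Real.log 2 := by
  simp only [natCondMutualInfo, condMutualInfo, natEntropy]; ring

theorem natCondMutualInfo_tensorPower {ρ : Matrix (A × B × C) (A × B × C) ℂ} (hρ : IsState ρ)
    (n : ℕ) : natCondMutualInfo (tensorPower ρ n) = n * natCondMutualInfo ρ := by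
  have hBC := hρ.1.marginalBC
  have hAB := hρ.1.marginalAB
  have hB := hρ.1.marginalB
  rw [natCondMutualInfo, marginalAB_tensorPower, marginalBC_tensorPower, marginalB_tensorPower,
    tensorPower_eq, natEntropy_submatrix (hAB.isHermitian.diagonalizes.piPower n).isHermitian,
    natEntropy_submatrix (hBC.isHermitian.diagonalizes.piPower n).isHermitian,
    natEntropy_submatrix (hρ.1.isHermitian.diagonalizes.piPower n).isHermitian,
    natEntropy_piPower hAB.isHermitian ((trace_marginalAB ρ).trans hρ.2),
    natEntropy_piPower hBC.isHermitian ((trace_marginalBC ρ).trans hρ.2),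
    natEntropy_piPower hB.isHermitian ((trace_marginalB ρ).trans hρ.2),
    natEntropy_piPower hρ.1.isHermitian hρ.2, natCondMutualInfo]
  ring

end Marginals

/-! ### Operations on one factor -/

section LocalOperations

variable {ι k m n : Type*} [Fintype ι] [Fintype k] [DecidableEq k] [Fintype m]

omit [Fintype k] [DecidableEq k] [Fintype m] in
theorem tensorId_apply (Φ : Matrix m m ℂ →ₗ[ℂ] Matrix n n ℂ) (X : Matrix (m × k) (m × k) ℂ)
    (p q : n × k) :
    tensorId k Φ X p q = Φ (Matrix.of fun i j => X (i, p.2) (j, q.2)) p.1 q.1 := rfl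

omit [Fintype k] [DecidableEq k] [Fintype m] in
theorem tensorId_eq_idTensor (Φ : Matrix m m ℂ →ₗ[ℂ] Matrix n n ℂ)
    (X : Matrix (m × k) (m × k) ℂ) :
    tensorId k Φ X =
      (idTensor k Φ (X.submatrix (Equiv.prodComm k m) (Equiv.prodComm k m))).submatrix
        (Equiv.prodComm n k) (Equiv.prodComm n k) := rfl

theorem tensorId_krausMap (K : ι → Matrix n m ℂ) (X : Matrix (m × k) (m × k) ℂ) :
    tensorId k (krausMap K) X = krausMap (fun i => K i ⊗ₖ (1 : Matrix k k ℂ)) X := by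
  ext ⟨a, c⟩ ⟨b, d⟩
  rw [tensorId_apply, krausMap_apply_apply, krausMap_apply_apply]
  refine Finset.sum_congr rfl fun i _ => ?_
  simp [Fintype.sum_prod_type, Matrix.one_apply, apply_ite star]

variable [Fintype n]

omit [Fintype k] [DecidableEq k] in
theorem traceFst_tensorId {Φ : Matrix m m ℂ →ₗ[ℂ] Matrix n n ℂ}
    (hΦ : ∀ X, (Φ X).trace = X.trace) (X : Matrix (m × k) (m × k) ℂ) :
    traceFst (tensorId k Φ X) = traceFst X := by
  ext c d
  exact hΦ (Matrix.of fun i j => X (i, c) (j, d))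

omit [Fintype k] [DecidableEq k] [Fintype m] [Fintype n] in
theorem marginalAB_tensorId {l : Type*} [Fintype l] (Φ : Matrix m m ℂ →ₗ[ℂ] Matrix n n ℂ)
    (X : Matrix (m × k × l) (m × k × l) ℂ) :
    marginalAB (tensorId (k × l) Φ X) = tensorId k Φ (marginalAB X) := by
  ext ⟨a, c⟩ ⟨b, d⟩
  have : (Matrix.of fun i j => marginalAB X (i, c) (j, d)) =
      ∑ e, Matrix.of fun i j => X (i, c, e) (j, d, e) := by
    ext i j; simp [marginalAB_apply, Matrix.sum_apply]
  rw [tensorId_apply, this, map_sum, Matrix.sum_apply]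
  rfl

theorem IsQuantumOperation.posSemidef_idTensor [DecidableEq m] [DecidableEq n]
    {Φ : Matrix m m ℂ →ₗ[ℂ] Matrix n n ℂ} (hΦ : IsQuantumOperation Φ)
    {X : Matrix (k × m) (k × m) ℂ} (hX : X.PosSemidef) : (idTensor k Φ X).PosSemidef := by
  obtain ⟨r, K, rfl, hK⟩ := hΦ.exists_kraus
  rw [idTensor_krausMap]
  exact posSemidef_krausMap _ hX

omit [DecidableEq k] in
theorem IsQuantumOperation.trace_idTensor {Φ : Matrix m m ℂ →ₗ[ℂ] Matrix n n ℂ}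
    (hΦ : IsQuantumOperation Φ) (X : Matrix (k × m) (k × m) ℂ) :
    (idTensor k Φ X).trace = X.trace := by
  rw [← trace_traceFst, traceFst_idTensor, hΦ.tracePreserving, trace_traceFst]

theorem trace_submatrix (X : Matrix m m ℂ) (e : n ≃ m) : (X.submatrix e e).trace = X.trace :=
  Equiv.sum_comp e fun i => X i i

theorem IsQuantumOperation.posSemidef_tensorId [DecidableEq m] [DecidableEq n]
    {Φ : Matrix m m ℂ →ₗ[ℂ] Matrix n n ℂ} (hΦ : IsQuantumOperation Φ)
    {X : Matrix (m × k) (m × k) ℂ} (hX : X.PosSemidef) : (tensorId k Φ X).PosSemidef := by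
  rw [tensorId_eq_idTensor]
  exact (hΦ.posSemidef_idTensor (hX.submatrix _)).submatrix _

omit [DecidableEq k] in
theorem IsQuantumOperation.trace_tensorId {Φ : Matrix m m ℂ →ₗ[ℂ] Matrix n n ℂ}
    (hΦ : IsQuantumOperation Φ) (X : Matrix (m × k) (m × k) ℂ) :
    (tensorId k Φ X).trace = X.trace := by
  rw [← trace_traceFst, traceFst_tensorId hΦ.tracePreserving, trace_traceFst]

theorem IsState.submatrix [DecidableEq m] [DecidableEq n] {X : Matrix m m ℂ} (hX : IsState X)
    (e : n ≃ m) : IsState (X.submatrix e e) :=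
  ⟨hX.1.submatrix e, (trace_submatrix X e).trans hX.2⟩

theorem IsQuantumOperation.isState_idTensor [DecidableEq m] [DecidableEq n]
    {Φ : Matrix m m ℂ →ₗ[ℂ] Matrix n n ℂ} (hΦ : IsQuantumOperation Φ)
    {X : Matrix (k × m) (k × m) ℂ} (hX : IsState X) : IsState (idTensor k Φ X) :=
  ⟨hΦ.posSemidef_idTensor hX.1, (hΦ.trace_idTensor X).trans hX.2⟩

theorem IsQuantumOperation.isState_tensorId [DecidableEq m] [DecidableEq n]
    {Φ : Matrix m m ℂ →ₗ[ℂ] Matrix n n ℂ} (hΦ : IsQuantumOperation Φ)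
    {X : Matrix (m × k) (m × k) ℂ} (hX : IsState X) : IsState (tensorId k Φ X) :=
  ⟨hΦ.posSemidef_tensorId hX.1, (hΦ.trace_tensorId X).trans hX.2⟩

/-- Data processing for the conditional entropy, with the tensor factors exchanged. -/
theorem condEntropy_le_tensorId [DecidableEq m] [DecidableEq n]
    {Φ : Matrix m m ℂ →ₗ[ℂ] Matrix n n ℂ} (hΦ : IsQuantumOperation Φ)
    {X : Matrix (m × k) (m × k) ℂ} (hX : IsState X) :
    natEntropy X - natEntropy (traceSnd X) ≤
      natEntropy (tensorId k Φ X) - natEntropy (traceSnd (tensorId k Φ X)) := by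
  have hX' := hX.submatrix (Equiv.prodComm k m)
  have h := condEntropy_le_idTensor hΦ hX'.1
  have h2 := natEntropy_submatrix (hΦ.isState_idTensor hX').1.isHermitian (Equiv.prodComm n k)
  rw [← tensorId_eq_idTensor] at h2
  rw [natEntropy_submatrix hX.1.isHermitian, ← h2] at h
  exact h

end LocalOperations

/-! ### Random unitary operations -/

section RandomUnitary

variable {A B C : Type*} [Fintype A] [Fintype B] [Fintype C]
  [DecidableEq A] [DecidableEq B] [DecidableEq C]

theorem conjTranspose_mul_self_unitary (V : Matrix.unitaryGroup A ℂ) :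
    (V : Matrix A A ℂ)ᴴ * (V : Matrix A A ℂ) = 1 := by
  rw [← star_eq_conjTranspose]; exact Unitary.coe_star_mul_self V

omit [DecidableEq A] in
/-- Each term of the average that defines `randomUnitary` is a local operation on `A`. -/
theorem kronecker_one_conj_eq_tensorId {k : Type*} [Fintype k] [DecidableEq k] (V : Matrix A A ℂ)
    (X : Matrix (A × k) (A × k) ℂ) :
    (V ⊗ₖ (1 : Matrix k k ℂ)) * X * (V ⊗ₖ (1 : Matrix k k ℂ))ᴴ =
      tensorId k (krausMap fun _ : Unit => V) X := by
  rw [tensorId_krausMap, krausMap_apply]; simp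

theorem marginalAB_randomUnitary {K : ℕ} (V : Fin K → Matrix.unitaryGroup A ℂ)
    (X : Matrix (A × B × C) (A × B × C) ℂ) :
    marginalAB (randomUnitary V X) =
      ∑ k, (((K : ℝ)⁻¹ : ℝ) : ℂ) • (((V k : Matrix A A ℂ) ⊗ₖ (1 : Matrix B B ℂ)) * marginalAB X *
        ((V k : Matrix A A ℂ) ⊗ₖ (1 : Matrix B B ℂ))ᴴ) := by
  simp only [randomUnitary, kronecker_one_conj_eq_tensorId, ← marginalAB_tensorId]
  ext p q
  simp only [marginalAB_apply, Matrix.smul_apply, Matrix.sum_apply, Finset.smul_sum]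
  rw [Finset.sum_comm]
  simp

theorem marginalBC_randomUnitary {K : ℕ} (hK : 0 < K) (V : Fin K → Matrix.unitaryGroup A ℂ)
    (X : Matrix (A × B × C) (A × B × C) ℂ) :
    marginalBC (randomUnitary V X) = marginalBC X := by
  have h1 : marginalBC (randomUnitary V X) = (K : ℂ)⁻¹ • ∑ k,
      traceFst (tensorId (B × C) (krausMap fun _ : Unit => (V k : Matrix A A ℂ)) X) := by
    simp only [randomUnitary, kronecker_one_conj_eq_tensorId]
    ext p q
    simp only [marginalBC_apply, traceFst, Matrix.smul_apply, Matrix.sum_apply, Finset.smul_sum]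
    rw [Finset.sum_comm]
  have h2 : ∀ k, traceFst (tensorId (B × C) (krausMap fun _ : Unit => (V k : Matrix A A ℂ)) X) =
      marginalBC X := fun k =>
    traceFst_tensorId (trace_krausMap _ (by simp [conjTranspose_mul_self_unitary])) X
  have hK' : (K : ℂ) ≠ 0 := by exact_mod_cast hK.ne'
  rw [h1]
  simp only [h2, Finset.sum_const, Finset.card_univ, Fintype.card_fin, ← Nat.cast_smul_eq_nsmul ℂ,
    smul_smul, inv_mul_cancel₀ hK', one_smul]

theorem marginalB_randomUnitary {K : ℕ} (hK : 0 < K) (V : Fin K → Matrix.unitaryGroup A ℂ)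
    (X : Matrix (A × B × C) (A × B × C) ℂ) :
    marginalB (randomUnitary V X) = marginalB X := by
  rw [← traceSnd_marginalBC, marginalBC_randomUnitary hK, traceSnd_marginalBC]

theorem isState_randomUnitary {K : ℕ} (hK : 0 < K) (V : Fin K → Matrix.unitaryGroup A ℂ)
    {X : Matrix (A × B × C) (A × B × C) ℂ} (hX : IsState X) : IsState (randomUnitary V X) := by
  constructor
  · refine (posSemidef_sum _ fun k _ => hX.1.mul_mul_conjTranspose_same _).smul ?_
    simp
  · rw [← trace_marginalBC, marginalBC_randomUnitary hK, trace_marginalBC, hX.2]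

/-- A random unitary operation with `K` unitaries increases the entropy by at most `log K`. -/
theorem natEntropy_randomUnitary_le {K : ℕ} (hK : 0 < K) (V : Fin K → Matrix.unitaryGroup A ℂ)
    {X : Matrix (A × B × C) (A × B × C) ℂ} (hX : IsState X) :
    natEntropy (randomUnitary V X) ≤ natEntropy X + Real.log K := by
  have hK' : (K : ℝ) ≠ 0 := by exact_mod_cast hK.ne'
  have hVV : ∀ k, ((V k : Matrix A A ℂ) ⊗ₖ (1 : Matrix (B × C) (B × C) ℂ))ᴴ *
      ((V k : Matrix A A ℂ) ⊗ₖ (1 : Matrix (B × C) (B × C) ℂ)) = 1 := by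
    intro k
    rw [conjTranspose_kronecker, ← mul_kronecker_mul, conjTranspose_mul_self_unitary]
    simp
  have h1 : randomUnitary V X = ∑ k, (((K : ℝ)⁻¹ : ℝ) : ℂ) •
      (((V k : Matrix A A ℂ) ⊗ₖ (1 : Matrix (B × C) (B × C) ℂ)) * X *
        ((V k : Matrix A A ℂ) ⊗ₖ (1 : Matrix (B × C) (B × C) ℂ))ᴴ) := by
    rw [randomUnitary, Finset.smul_sum]; simp
  have hpos : ∀ k, (((V k : Matrix A A ℂ) ⊗ₖ (1 : Matrix (B × C) (B × C) ℂ)) * X *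
        ((V k : Matrix A A ℂ) ⊗ₖ (1 : Matrix (B × C) (B × C) ℂ))ᴴ).PosSemidef :=
    fun k => hX.1.mul_mul_conjTranspose_same _
  have h0 : (0 : ℂ) ≤ (((K : ℝ)⁻¹ : ℝ) : ℂ) := by
    have : (0 : ℝ) ≤ (K : ℝ)⁻¹ := by positivity
    exact_mod_cast this
  rw [h1]
  refine (natEntropy_sum_le _ _ fun k _ => (hpos k).smul h0).trans_eq ?_
  have h2 : ∀ k, natEntropy ((((K : ℝ)⁻¹ : ℝ) : ℂ) •
      (((V k : Matrix A A ℂ) ⊗ₖ (1 : Matrix (B × C) (B × C) ℂ)) * X *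
        ((V k : Matrix A A ℂ) ⊗ₖ (1 : Matrix (B × C) (B × C) ℂ))ᴴ)) =
      (K : ℝ)⁻¹ * natEntropy X + (K : ℝ)⁻¹ * Real.log K := by
    intro k
    rw [natEntropy_smul (hpos k).isHermitian, natEntropy_conj hX.1.isHermitian (hVV k),
      trace_mul_cycle, hVV, Matrix.one_mul, hX.2, negMulLog, Real.log_inv]
    simp
  rw [Finset.sum_congr rfl fun k _ => h2 k]
  simp only [Finset.sum_const, Finset.card_univ, Fintype.card_fin, nsmul_eq_mul]
  field_simp

theorem natEntropy_marginalAB_le_randomUnitary {K : ℕ} (hK : 0 < K)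
    (V : Fin K → Matrix.unitaryGroup A ℂ) {X : Matrix (A × B × C) (A × B × C) ℂ}
    (hX : X.PosSemidef) :
    natEntropy (marginalAB X) ≤ natEntropy (marginalAB (randomUnitary V X)) := by
  have hK' : (K : ℝ) ≠ 0 := by exact_mod_cast hK.ne'
  have hVV : ∀ k, ((V k : Matrix A A ℂ) ⊗ₖ (1 : Matrix B B ℂ))ᴴ *
      ((V k : Matrix A A ℂ) ⊗ₖ (1 : Matrix B B ℂ)) = 1 := by
    intro k
    rw [conjTranspose_kronecker, ← mul_kronecker_mul, conjTranspose_mul_self_unitary]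
    simp
  have h := sum_smul_natEntropy_le Finset.univ (fun _ : Fin K => (K : ℝ)⁻¹)
    (fun k => ((V k : Matrix A A ℂ) ⊗ₖ (1 : Matrix B B ℂ)) * marginalAB X *
        ((V k : Matrix A A ℂ) ⊗ₖ (1 : Matrix B B ℂ))ᴴ) (fun _ _ => by positivity)
    (by simp [hK']) (fun k _ => hX.marginalAB.mul_mul_conjTranspose_same _)
  rw [marginalAB_randomUnitary]
  refine le_trans (le_of_eq ?_) h
  simp [natEntropy_conj hX.marginalAB.isHermitian (hVV _), hK']

/-- The conditional mutual information decreases by at most `log K` under a random unitary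
operation with `K` unitaries on `A`. -/
theorem natCondMutualInfo_le_randomUnitary {K : ℕ} (hK : 0 < K)
    (V : Fin K → Matrix.unitaryGroup A ℂ) {X : Matrix (A × B × C) (A × B × C) ℂ}
    (hX : IsState X) :
    natCondMutualInfo X ≤ natCondMutualInfo (randomUnitary V X) + Real.log K := by
  have h1 := natEntropy_randomUnitary_le hK V hX
  have h2 := natEntropy_marginalAB_le_randomUnitary hK V hX.1
  rw [natCondMutualInfo, natCondMutualInfo, marginalBC_randomUnitary hK,
    marginalB_randomUnitary hK]
  linarith

end RandomUnitary

/-! ### Recoverable states have small conditional mutual information -/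

section Recoverable

variable {A B C : Type*} [Fintype A] [Fintype B] [Fintype C]
  [DecidableEq A] [DecidableEq B] [DecidableEq C]

omit [DecidableEq A] [Fintype B] [DecidableEq B] [Fintype C] [DecidableEq C] in
theorem trace_re_nonneg {X : Matrix A A ℂ} (hX : X.PosSemidef) : 0 ≤ X.trace.re :=
  (Complex.le_def.mp hX.trace_nonneg).1

/-- States at trace distance at most `ε` satisfy the hypothesis of the continuity estimate. -/
theorem exists_add_eq_add_of_traceNorm_le {X Y : Matrix A A ℂ} {ε : ℝ} (hX : X.PosSemidef)
    (hY : Y.PosSemidef) (h : traceNorm (X - Y) ≤ ε) :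
    ∃ P N : Matrix A A ℂ, P.PosSemidef ∧ N.PosSemidef ∧ Y + P = X + N ∧ P.trace.re ≤ ε ∧
      N.trace.re ≤ ε := by
  obtain ⟨P, N, hP, hN, he, ht⟩ := exists_eq_sub_of_isHermitian (hX.isHermitian.sub hY.isHermitian)
  have h1 := trace_re_nonneg hP
  have h2 := trace_re_nonneg hN
  refine ⟨P, N, hP, hN, ?_, by linarith, by linarith⟩
  rw [sub_eq_sub_iff_add_eq_add] at he
  rw [he, add_comm]

theorem natCondMutualInfo_le_of_recoverableFromBC {τ : Matrix (A × B × C) (A × B × C) ℂ} {ε : ℝ}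
    (hτ : IsState τ) (h : RecoverableFromBC ε τ) :
    natCondMutualInfo τ ≤ ε * (Real.log (Fintype.card (A × B × C)) +
      Real.log (Fintype.card (A × B))) + 2 * (1 + ε * (1 + ε)) := by
  obtain ⟨Φ, hΦ, hε⟩ := h
  have hBC : IsState (marginalBC τ) := ⟨hτ.1.marginalBC, (trace_marginalBC τ).trans hτ.2⟩
  have hω' := hΦ.isState_tensorId hBC
  have hω := hω'.submatrix (Equiv.prodAssoc A B C).symm
  have hent := natEntropy_submatrix hω'.1.isHermitian (Equiv.prodAssoc A B C).symm
  have hAB : marginalAB ((tensorId C Φ (marginalBC τ)).submatrix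
      (Equiv.prodAssoc A B C).symm (Equiv.prodAssoc A B C).symm) =
      traceSnd (tensorId C Φ (marginalBC τ)) := rfl
  have hdata := condEntropy_le_tensorId hΦ hBC
  rw [← hent, ← hAB, traceSnd_marginalBC] at hdata
  set ω := (tensorId C Φ (marginalBC τ)).submatrix
      (Equiv.prodAssoc A B C).symm (Equiv.prodAssoc A B C).symm
  obtain ⟨P, N, hP, hN, he, hPt, hNt⟩ := exists_add_eq_add_of_traceNorm_le hτ.1 hω.1 hε
  have h1 := natEntropy_le_of_add_eq_add hω.1 hω.2 hτ.1 hP hN he hPt hNt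
  have he' : marginalAB τ + marginalAB N = marginalAB ω + marginalAB P := by
    rw [← marginalAB_add, ← marginalAB_add, he]
  have h2 := natEntropy_le_of_add_eq_add (δ := ε) hτ.1.marginalAB ((trace_marginalAB τ).trans hτ.2)
    hω.1.marginalAB hN.marginalAB hP.marginalAB he' (by rwa [trace_marginalAB])
    (by rwa [trace_marginalAB])
  rw [natCondMutualInfo]
  linarith

theorem natCondMutualInfo_le_of_recoverableFromAB {τ : Matrix (A × B × C) (A × B × C) ℂ} {ε : ℝ}
    (hτ : IsState τ) (h : RecoverableFromAB ε τ) :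
    natCondMutualInfo τ ≤ ε * (Real.log (Fintype.card (A × B × C)) +
      Real.log (Fintype.card (B × C))) + 2 * (1 + ε * (1 + ε)) := by
  obtain ⟨Φ, hΦ, hε⟩ := h
  have hAB : IsState (marginalAB τ) := ⟨hτ.1.marginalAB, (trace_marginalAB τ).trans hτ.2⟩
  have hω := hΦ.isState_idTensor hAB
  have hdata := condEntropy_le_idTensor hΦ hAB.1
  set ω := idTensor A Φ (marginalAB τ)
  have hdata' : natEntropy (marginalAB τ) - natEntropy (marginalB τ) ≤
    natEntropy ω - natEntropy (marginalBC ω) := hdata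
  obtain ⟨P, N, hP, hN, he, hPt, hNt⟩ := exists_add_eq_add_of_traceNorm_le hτ.1 hω.1 hε
  have h1 := natEntropy_le_of_add_eq_add hω.1 hω.2 hτ.1 hP hN he hPt hNt
  have he' : marginalBC τ + marginalBC N = marginalBC ω + marginalBC P := by
    rw [← marginalBC_add, ← marginalBC_add, he]
  have h2 := natEntropy_le_of_add_eq_add (δ := ε) hτ.1.marginalBC ((trace_marginalBC τ).trans hτ.2)
    hω.1.marginalBC hN.marginalBC hP.marginalBC he' (by rwa [trace_marginalBC])
    (by rwa [trace_marginalBC])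
  rw [natCondMutualInfo]
  linarith

end Recoverable

/-! ### Lower bounds on the costs -/

section LowerBound

variable {A B C : Type*} [Fintype A] [Fintype B] [Fintype C]
  [DecidableEq A] [DecidableEq B] [DecidableEq C]

theorem log_numUnitaries_le {n : ℕ} {R : ℝ} (h : 0 < numUnitaries n R) :
    Real.log (numUnitaries n R) ≤ n * (R * Real.log 2) := by
  have h1 : (numUnitaries n R : ℝ) ≤ (2 : ℝ) ^ ((n : ℝ) * R) :=
    Nat.floor_le (Real.rpow_nonneg (by norm_num) _)
  have h2 := Real.log_le_log (by exact_mod_cast h) h1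
  rw [Real.log_rpow (by norm_num)] at h2
  linarith

/-- A bound on `n I` by `n R` with an error that is `n` times an arbitrarily small number plus a
constant forces `I ≤ R`. -/
theorem le_of_eventually_mul_le {I R L : ℝ} (hL : 0 ≤ L)
    (h : ∀ ε : ℝ, 0 < ε → ∃ N : ℕ, ∀ n : ℕ, N ≤ n →
      n * I ≤ n * R + (ε * (n * L) + 2 * (1 + ε * (1 + ε)))) : I ≤ R := by
  by_contra! hlt
  set g := I - R with hg
  have hg0 : 0 < g := sub_pos.mpr hlt
  set ε := min 1 (g / (2 * (L + 1))) with hε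
  have hε0 : 0 < ε := lt_min one_pos (by positivity)
  have hε1 : ε ≤ 1 := min_le_left _ _
  have hεL : ε * L ≤ g / 2 := by
    calc ε * L ≤ ε * (L + 1) := by gcongr; linarith
      _ ≤ g / (2 * (L + 1)) * (L + 1) := by gcongr; exact min_le_right _ _
      _ = g / 2 := by field_simp
  obtain ⟨N, hN⟩ := h ε hε0
  -- the constant part of the error is at most `6`, and the other part at most `n g / 2`
  obtain ⟨M, hM⟩ := exists_nat_gt (12 / g)
  have h1 := hN (max N M) (le_max_left _ _)
  have h2 : (M : ℝ) ≤ (max N M : ℕ) := by exact_mod_cast le_max_right N M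
  set n : ℝ := ((max N M : ℕ) : ℝ)
  have h3 : 12 < n * g := by
    rw [div_lt_iff₀ hg0] at hM
    exact hM.trans_le (mul_le_mul_of_nonneg_right h2 hg0.le)
  have hn : 0 ≤ n := Nat.cast_nonneg _
  have h4 : n * (ε * L) ≤ n * (g / 2) := mul_le_mul_of_nonneg_left hεL hn
  have h5 : ε * (1 + ε) ≤ 2 := by nlinarith
  have h6 : n * g = n * I - n * R := by rw [hg]; ring
  linarith

omit [Fintype B] [Fintype C] [DecidableEq A] [DecidableEq B] [DecidableEq C] in
theorem log_card_pi (n : ℕ) :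
    Real.log (Fintype.card (Fin n → A)) = n * Real.log (Fintype.card A) := by
  rw [Fintype.card_fun, Fintype.card_fin, Nat.cast_pow, Real.log_pow]

theorem condMutualInfo_le_of_markovianizedRecBC {ρ : Matrix (A × B × C) (A × B × C) ℂ}
    (hρ : IsState ρ) {R : ℝ} (h : MarkovianizedRecBC ρ R) : condMutualInfo ρ ≤ R := by
  have hl2 : 0 < Real.log 2 := Real.log_pos one_lt_two
  refine le_of_mul_le_mul_right ?_ hl2
  rw [← natCondMutualInfo_eq]
  refine le_of_eventually_mul_le (L := Real.log (Fintype.card (A × B × C)) +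
    Real.log (Fintype.card (A × B)))
    (add_nonneg (Real.log_natCast_nonneg _) (Real.log_natCast_nonneg _)) fun ε hε => ?_
  obtain ⟨N, hN⟩ := h ε hε
  refine ⟨N, fun n hn => ?_⟩
  obtain ⟨hK, V, hV⟩ := hN n hn
  have hn' := isState_tensorPower hρ n
  have h1 := natCondMutualInfo_le_randomUnitary hK V hn'
  have h2 := natCondMutualInfo_le_of_recoverableFromBC (isState_randomUnitary hK V hn') hV
  have h3 := log_numUnitaries_le hK
  rw [natCondMutualInfo_tensorPower hρ] at h1
  have h4 : Real.log (Fintype.card ((Fin n → A) × (Fin n → B) × (Fin n → C))) =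
      n * Real.log (Fintype.card (A × B × C)) := by
    rw [← log_card_pi]
    congr 2
    simp only [Fintype.card_prod, Fintype.card_fun, mul_pow]
  have h5 : Real.log (Fintype.card ((Fin n → A) × (Fin n → B))) =
      n * Real.log (Fintype.card (A × B)) := by
    rw [← log_card_pi]
    congr 2
    simp only [Fintype.card_prod, Fintype.card_fun, mul_pow]
  rw [h4, h5, ← mul_add] at h2
  linarith

theorem condMutualInfo_le_of_markovianizedRecAB {ρ : Matrix (A × B × C) (A × B × C) ℂ}
    (hρ : IsState ρ) {R : ℝ} (h : MarkovianizedRecAB ρ R) : condMutualInfo ρ ≤ R := by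
  have hl2 : 0 < Real.log 2 := Real.log_pos one_lt_two
  refine le_of_mul_le_mul_right ?_ hl2
  rw [← natCondMutualInfo_eq]
  refine le_of_eventually_mul_le (L := Real.log (Fintype.card (A × B × C)) +
    Real.log (Fintype.card (B × C)))
    (add_nonneg (Real.log_natCast_nonneg _) (Real.log_natCast_nonneg _)) fun ε hε => ?_
  obtain ⟨N, hN⟩ := h ε hε
  refine ⟨N, fun n hn => ?_⟩
  obtain ⟨hK, V, hV⟩ := hN n hn
  have hn' := isState_tensorPower hρ n
  have h1 := natCondMutualInfo_le_randomUnitary hK V hn'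
  have h2 := natCondMutualInfo_le_of_recoverableFromAB (isState_randomUnitary hK V hn') hV
  have h3 := log_numUnitaries_le hK
  rw [natCondMutualInfo_tensorPower hρ] at h1
  have h4 : Real.log (Fintype.card ((Fin n → A) × (Fin n → B) × (Fin n → C))) =
      n * Real.log (Fintype.card (A × B × C)) := by
    rw [← log_card_pi]
    congr 2
    simp only [Fintype.card_prod, Fintype.card_fun, mul_pow]
  have h5 : Real.log (Fintype.card ((Fin n → B) × (Fin n → C))) =
      n * Real.log (Fintype.card (B × C)) := by
    rw [← log_card_pi]
    congr 2
    simp only [Fintype.card_prod, Fintype.card_fun, mul_pow]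
  rw [h4, h5, ← mul_add] at h2
  linarith

end LowerBound

/-! ### Markov states are recoverable -/

section Insert

variable {ι s x m n : Type*} [Fintype m] [Fintype n] [Fintype x]

theorem IsQuantumOperation.comp {l : Type*} [Fintype l] {Φ : Matrix m m ℂ →ₗ[ℂ] Matrix n n ℂ}
    {Ψ : Matrix n n ℂ →ₗ[ℂ] Matrix l l ℂ} (hΨ : IsQuantumOperation Ψ)
    (hΦ : IsQuantumOperation Φ) : IsQuantumOperation (Ψ ∘ₗ Φ) where
  completelyPositive d X hX :=
    hΨ.completelyPositive d _ (hΦ.completelyPositive d X hX)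
  tracePreserving X := (hΨ.tracePreserving _).trans (hΦ.tracePreserving X)

variable [DecidableEq ι]

/-- The operation that dephases a classical register `ι`, discards a subsystem `x`, and prepares the
state `τ i` of a system `s` conditioned on the register. A basis vector `p` of the output system `n`
carries the register value `blk p` and the basis vector `st p` of the prepared system; the input
basis vectors from which it arises are `pre a p`, where `a` is the discarded value. -/
def insertMap (blk : n → ι) (st : n → s) (pre : x → n → m) (τ : ι → Matrix s s ℂ) :
    Matrix m m ℂ →ₗ[ℂ] Matrix n n ℂ where
  toFun Y := Matrix.of fun p q =>
    if blk p = blk q then τ (blk p) (st p) (st q) * ∑ a, Y (pre a p) (pre a q) else 0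
  map_add' X Y := by
    ext p q
    simp only [of_apply, Matrix.add_apply, Finset.sum_add_distrib, mul_add]
    split_ifs <;> simp
  map_smul' c X := by
    ext p q
    simp only [of_apply, Matrix.smul_apply, smul_eq_mul, ← Finset.mul_sum, RingHom.id_apply]
    split_ifs
    · ring
    · simp

omit [Fintype m] [Fintype n] in
theorem insertMap_apply (blk : n → ι) (st : n → s) (pre : x → n → m) (τ : ι → Matrix s s ℂ)
    (Y : Matrix m m ℂ) (p q : n) : insertMap blk st pre τ Y p q =
      if blk p = blk q then τ (blk p) (st p) (st q) * ∑ a, Y (pre a p) (pre a q) else 0 := rfl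

theorem posSemidef_blockDiagonal [Fintype ι] [Fintype s] {τ : ι → Matrix s s ℂ}
    (hτ : ∀ i, (τ i).PosSemidef) : (blockDiagonal τ).PosSemidef := by
  have h : blockDiagonal τ = ∑ i, (τ i) ⊗ₖ (single i i (1 : ℂ)) := by
    ext ⟨a, i⟩ ⟨b, j⟩
    rw [Matrix.sum_apply, Finset.sum_eq_single i]
    · by_cases hij : i = j <;> simp [blockDiagonal_apply, hij]
    · intro k _ hk; simp [hk]
    · simp
  rw [h]
  refine posSemidef_sum _ fun i _ => (hτ i).kronecker ?_
  have := posSemidef_vecMulVec_self_star (Pi.single i (1 : ℂ) : ι → ℂ)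
  have h2 : vecMulVec (Pi.single i (1 : ℂ) : ι → ℂ) (star (Pi.single i (1 : ℂ))) =
      single i i (1 : ℂ) := by
    rw [← Pi.single_star, star_one, single_eq_single_vecMulVec_single]
  rwa [h2] at this

/-- Complete positivity of `insertMap` is an instance of the Schur product theorem. -/
theorem isQuantumOperation_insertMap [Fintype ι] [Fintype s] {blk : n → ι} {st : n → s}
    {pre : x → n → m} {τ : ι → Matrix s s ℂ} (hτ : ∀ i, (τ i).PosSemidef)
    (htr : ∀ Y, (insertMap blk st pre τ Y).trace = Y.trace) :
    IsQuantumOperation (insertMap blk st pre τ) where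
  completelyPositive d X hX := by
    have h : idTensor (Fin d) (insertMap blk st pre τ) X =
        ((blockDiagonal τ).submatrix (fun p : Fin d × n => (st p.2, blk p.2))
          (fun p : Fin d × n => (st p.2, blk p.2))) ⊙
        ∑ a, X.submatrix (fun p : Fin d × n => (p.1, pre a p.2))
          (fun p : Fin d × n => (p.1, pre a p.2)) := by
      ext p q
      rw [idTensor_apply, insertMap_apply, hadamard_apply, submatrix_apply, blockDiagonal_apply,
        Matrix.sum_apply, ite_mul, zero_mul]
      rfl
    rw [h]
    exact ((posSemidef_blockDiagonal hτ).submatrix _).hadamard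
      (posSemidef_sum _ fun a _ => hX.submatrix _)
  tracePreserving := htr

end Insert

section Markov

variable {A B C E : Type*} [Fintype A] [Fintype B] [Fintype C] [Fintype E]
  [DecidableEq A] [DecidableEq B] [DecidableEq C] [DecidableEq E]

/-- Conjugation by an isometry has a left inverse that is a quantum operation: conjugate by the
adjoint, and prepare a fixed state on the orthogonal complement of the range. -/
theorem exists_kraus_leftInverse [Nonempty B] {Γ : Matrix E B ℂ} (hΓ : Γᴴ * Γ = 1) :
    ∃ G : Option E → Matrix B E ℂ, ∑ o, (G o)ᴴ * G o = 1 ∧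
      ∀ X, krausMap G (krausMap (fun _ : Unit => Γ) X) = X := by
  obtain ⟨b⟩ := ‹Nonempty B›
  set P : Matrix E E ℂ := 1 - Γ * Γᴴ with hP
  have hPΓ : P * Γ = 0 := by
    rw [hP, Matrix.sub_mul, Matrix.mul_assoc, hΓ]; simp
  have hPH : Pᴴ = P := by rw [hP]; simp
  have hPP : Pᴴ * P = P := by
    rw [hPH]; nth_rw 2 [hP]
    rw [Matrix.mul_sub, Matrix.mul_one, ← Matrix.mul_assoc, hPΓ, Matrix.zero_mul, sub_zero]
  let Q : E → Matrix B E ℂ := fun e => (single b e (1 : ℂ) : Matrix B E ℂ) * P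
  have hQ : ∀ e, (Q e)ᴴ * Q e = Pᴴ * ((single e e (1 : ℂ) : Matrix E E ℂ) * P) := by
    intro e
    simp only [Q]
    rw [conjTranspose_mul, conjTranspose_single, star_one, Matrix.mul_assoc,
      ← Matrix.mul_assoc (single e b _), single_mul_single_same, one_mul]
  have hQΓ : ∀ e (X : Matrix B B ℂ), Q e * (Γ * X * Γᴴ) * (Q e)ᴴ = 0 := by
    intro e X
    have : Q e * Γ = 0 := by simp only [Q]; rw [Matrix.mul_assoc, hPΓ, Matrix.mul_zero]
    rw [← Matrix.mul_assoc, ← Matrix.mul_assoc, this]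
    simp
  have h1 : ∑ e : E, (single e e (1 : ℂ) : Matrix E E ℂ) = 1 := by
    ext i j
    rw [Matrix.sum_apply, Finset.sum_eq_single i]
    · simp [single_apply, Matrix.one_apply]
    · intro k _ hk; simp [hk]
    · simp
  refine ⟨fun o => o.elim Γᴴ Q, ?_, fun X => ?_⟩
  · simp only [Fintype.sum_option, Option.elim, hQ, conjTranspose_conjTranspose]
    rw [← Finset.mul_sum, ← Finset.sum_mul, h1, Matrix.one_mul, hPP, hP]
    simp
  · simp only [krausMap_apply, Fintype.sum_option, Option.elim, Finset.univ_unique,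
      Finset.sum_singleton, hQΓ, Finset.sum_const_zero, add_zero, conjTranspose_conjTranspose]
    rw [Matrix.mul_assoc, Matrix.mul_assoc, hΓ, Matrix.mul_one, ← Matrix.mul_assoc, hΓ,
      Matrix.one_mul]

omit [Fintype E] [DecidableEq B] in
theorem sum_conjTranspose_mul_kronecker_one {ι : Type*} [Fintype ι] {K : ι → Matrix B E ℂ}
    (hK : ∑ i, (K i)ᴴ * K i = 1) :
    ∑ i, (K i ⊗ₖ (1 : Matrix C C ℂ))ᴴ * (K i ⊗ₖ (1 : Matrix C C ℂ)) = 1 := by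
  simp only [conjTranspose_kronecker, ← mul_kronecker_mul, conjTranspose_one, Matrix.one_mul]
  have := map_sum ((kroneckerBilinear (R := ℂ)).flip (1 : Matrix C C ℂ) :
      Matrix E E ℂ →ₗ[ℂ] Matrix (E × C) (E × C) ℂ)
    (fun i => (K i)ᴴ * K i) Finset.univ
  rw [hK] at this
  rw [← one_kronecker_one]
  exact this.symm

omit [Fintype A] [Fintype E] [DecidableEq A] [DecidableEq B] [DecidableEq E] in
theorem marginalAB_idTensor_krausMap {ι : Type*} [Fintype ι] (K : ι → Matrix E B ℂ)
    (X : Matrix (A × B × C) (A × B × C) ℂ) :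
    marginalAB (idTensor A (krausMap fun i => K i ⊗ₖ (1 : Matrix C C ℂ)) X) =
      idTensor A (krausMap K) (marginalAB X) := by
  ext ⟨a, e⟩ ⟨a', e'⟩
  have : (Matrix.of fun i j => marginalAB X (a, i) (a', j)) =
      ∑ c, Matrix.of fun i j => X (a, i, c) (a', j, c) := by
    ext i j; simp [marginalAB_apply, Matrix.sum_apply]
  rw [idTensor_apply, this, map_sum, Matrix.sum_apply, marginalAB_apply]
  refine Finset.sum_congr rfl fun c _ => ?_
  rw [idTensor_apply, ← tensorId_krausMap, tensorId_apply]
  rfl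

omit [Fintype B] [DecidableEq B] [DecidableEq E] in
theorem submatrix_prodAssoc_tensorId_krausMap {ι : Type*} [Fintype ι] (K : ι → Matrix B E ℂ)
    (Y : Matrix ((A × E) × C) ((A × E) × C) ℂ) :
    (tensorId C (krausMap fun i => (1 : Matrix A A ℂ) ⊗ₖ K i) Y).submatrix
        (Equiv.prodAssoc A B C).symm (Equiv.prodAssoc A B C).symm =
      idTensor A (krausMap fun i => K i ⊗ₖ (1 : Matrix C C ℂ))
        (Y.submatrix (Equiv.prodAssoc A E C).symm (Equiv.prodAssoc A E C).symm) := by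
  ext ⟨a, b, c⟩ ⟨a', b', c'⟩
  rw [idTensor_apply, ← tensorId_krausMap, tensorId_apply, submatrix_apply, tensorId_apply,
    ← idTensor_krausMap, idTensor_apply]
  rfl

/-- Markov states are exactly recoverable from either marginal. The recovery operation applies `Γ`,
dephases `b₀`, replaces `b_L` by a fresh `A b_L` in the state `σᵢ` (or `b_R` by a fresh `b_R C` in
the state `φᵢ`), and undoes `Γ` by its left inverse. -/
theorem IsMarkovState.recoverable {Υ : Matrix (A × B × C) (A × B × C) ℂ} (hΥ : IsMarkovState Υ) :
    (∃ Φ : Matrix B B ℂ →ₗ[ℂ] Matrix (A × B) (A × B) ℂ, IsQuantumOperation Φ ∧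
      (tensorId C Φ (marginalBC Υ)).submatrix
        (Equiv.prodAssoc A B C).symm (Equiv.prodAssoc A B C).symm = Υ) ∧
    ∃ Φ : Matrix B B ℂ →ₗ[ℂ] Matrix (B × C) (B × C) ℂ, IsQuantumOperation Φ ∧
      idTensor A Φ (marginalAB Υ) = Υ := by
  obtain ⟨hstate, d₀, dL, dR, Γ, q, σ, φ, hΓ, -, -, hσ, hφ, hform⟩ := hΥ
  have hB : Nonempty B := by
    by_contra hB
    rw [not_nonempty_iff] at hB
    have := hstate.2
    simp [Matrix.trace] at this
  obtain ⟨G, hG, hGΓ⟩ := exists_kraus_leftInverse hΓ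
  -- `Θ` is the image of `Υ` under `Γ`, and `G` takes it back to `Υ`
  set Θ := markovForm q σ φ with hΘ
  have hΘ' : idTensor A (krausMap fun _ : Unit => Γ ⊗ₖ (1 : Matrix C C ℂ)) Υ = Θ := by
    rw [idTensor_krausMap, krausMap_apply, ← hform]; simp
  have hback : idTensor A (krausMap fun o => G o ⊗ₖ (1 : Matrix C C ℂ)) Θ = Υ := by
    have h1 : ∀ Y : Matrix (B × C) (B × C) ℂ, krausMap (fun o => G o ⊗ₖ (1 : Matrix C C ℂ))
        (krausMap (fun _ : Unit => Γ ⊗ₖ (1 : Matrix C C ℂ)) Y) = Y := by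
      intro Y
      rw [← tensorId_krausMap, ← tensorId_krausMap]
      ext ⟨b, c⟩ ⟨b', c'⟩
      exact congrFun (congrFun (hGΓ (Matrix.of fun i j => Y (i, c) (j, c'))) b) b'
    rw [← hΘ']
    ext ⟨a, y⟩ ⟨a', y'⟩
    exact congrFun (congrFun (h1 (Matrix.of fun i j => Υ (a, i) (a', j))) y) y'
  have hΓop : IsQuantumOperation (krausMap fun _ : Unit => Γ) :=
    isQuantumOperation_krausMap (by simpa using hΓ)
  have hσ1 : ∀ i, ∑ p, σ i p p = 1 := fun i => (hσ i).2
  have hφ1 : ∀ i, ∑ p, φ i p p = 1 := fun i => (hφ i).2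
  constructor
  · let M : Matrix (Fin d₀ × Fin dL × Fin dR) (Fin d₀ × Fin dL × Fin dR) ℂ →ₗ[ℂ]
        Matrix (A × Fin d₀ × Fin dL × Fin dR) (A × Fin d₀ × Fin dL × Fin dR) ℂ :=
      insertMap (fun p => p.2.1) (fun p => (p.1, p.2.2.1)) (fun m p => (p.2.1, m, p.2.2.2)) σ
    have hM : IsQuantumOperation M := by
      refine isQuantumOperation_insertMap (fun i => (hσ i).1) fun Y => ?_
      simp only [Matrix.trace, diag_apply, insertMap_apply, if_true, Fintype.sum_prod_type]
      rw [Finset.sum_comm]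
      refine Finset.sum_congr rfl fun i _ => ?_
      have h1 := hσ1 i
      rw [Fintype.sum_prod_type] at h1
      simp only [← Finset.mul_sum]
      simp only [← Finset.sum_mul]
      rw [h1, one_mul, Finset.sum_comm]
    refine ⟨krausMap (fun o => (1 : Matrix A A ℂ) ⊗ₖ G o) ∘ₗ M ∘ₗ krausMap fun _ : Unit => Γ,
      (isQuantumOperation_krausMap (sum_conjTranspose_mul_one_kronecker hG)).comp
        (hM.comp hΓop), ?_⟩
    have h1 : tensorId C (krausMap fun _ : Unit => Γ) (marginalBC Υ) = marginalBC Θ := by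
      rw [tensorId_krausMap, ← hΘ']
      exact (traceFst_idTensor _ _).symm
    change (tensorId C (krausMap fun o => (1 : Matrix A A ℂ) ⊗ₖ G o)
      (tensorId C M (tensorId C (krausMap fun _ : Unit => Γ) (marginalBC Υ)))).submatrix _ _ = Υ
    rw [h1, submatrix_prodAssoc_tensorId_krausMap]
    -- it remains to see that `M` recovers `Θ` from its marginal
    refine Eq.trans (congrArg _ ?_) hback
    ext ⟨a, ⟨i, l, r⟩, c⟩ ⟨a', ⟨i', l', r'⟩, c'⟩
    rw [submatrix_apply, tensorId_apply, insertMap_apply]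
    simp only [Equiv.prodAssoc_symm_apply, of_apply, marginalBC_apply, hΘ, markovForm]
    by_cases h : i = i'
    · subst h
      have h1 := hσ1 i
      rw [Fintype.sum_prod_type, Finset.sum_comm] at h1
      simp only [if_true, mul_assoc]
      simp only [← Finset.mul_sum]
      simp only [← Finset.sum_mul]
      rw [h1]
      ring
    · simp [h]
  · let M : Matrix (Fin d₀ × Fin dL × Fin dR) (Fin d₀ × Fin dL × Fin dR) ℂ →ₗ[ℂ]
        Matrix ((Fin d₀ × Fin dL × Fin dR) × C) ((Fin d₀ × Fin dL × Fin dR) × C) ℂ :=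
      insertMap (fun p => p.1.1) (fun p => (p.1.2.2, p.2)) (fun m p => (p.1.1, p.1.2.1, m)) φ
    have hM : IsQuantumOperation M := by
      refine isQuantumOperation_insertMap (fun i => (hφ i).1) fun Y => ?_
      simp only [Matrix.trace, diag_apply, insertMap_apply, if_true, Fintype.sum_prod_type]
      refine Finset.sum_congr rfl fun i _ => Finset.sum_congr rfl fun l _ => ?_
      have h1 := hφ1 i
      rw [Fintype.sum_prod_type] at h1
      simp only [← Finset.sum_mul]
      rw [h1, one_mul]
    refine ⟨krausMap (fun o => G o ⊗ₖ (1 : Matrix C C ℂ)) ∘ₗ M ∘ₗ krausMap fun _ : Unit => Γ,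
      (isQuantumOperation_krausMap (sum_conjTranspose_mul_kronecker_one hG)).comp
        (hM.comp hΓop), ?_⟩
    have h1 : idTensor A (krausMap fun _ : Unit => Γ) (marginalAB Υ) = marginalAB Θ := by
      rw [← hΘ', marginalAB_idTensor_krausMap]
    change idTensor A (krausMap fun o => G o ⊗ₖ (1 : Matrix C C ℂ))
      (idTensor A M (idTensor A (krausMap fun _ : Unit => Γ) (marginalAB Υ))) = Υ
    rw [h1]
    refine Eq.trans (congrArg _ ?_) hback
    ext ⟨a, ⟨i, l, r⟩, c⟩ ⟨a', ⟨i', l', r'⟩, c'⟩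
    rw [idTensor_apply, insertMap_apply]
    simp only [of_apply, marginalAB_apply, hΘ, markovForm]
    by_cases h : i = i'
    · subst h
      have h1 := hφ1 i
      rw [Fintype.sum_prod_type] at h1
      simp only [if_true]
      simp only [← Finset.mul_sum]
      rw [h1]
      ring
    · simp [h]

end Markov

/-! ### Decomposability implies recoverability -/

section Decomposable

variable {A B C : Type*} [Fintype A] [Fintype B] [Fintype C]
  [DecidableEq A] [DecidableEq B] [DecidableEq C]

/-- A positive trace-preserving map moves points near one of its fixed points by at most twice
their distance to it. -/
theorem traceNorm_sub_map_le {Λ : Matrix A A ℂ → Matrix A A ℂ}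
    (hadd : ∀ X Y, Λ (X + Y) = Λ X + Λ Y) (hpos : ∀ X, X.PosSemidef → (Λ X).PosSemidef)
    (htr : ∀ X, (Λ X).trace = X.trace) {X Y : Matrix A A ℂ} (hX : X.IsHermitian)
    (hY : Y.IsHermitian) (hfix : Λ Y = Y) {ε : ℝ} (h : traceNorm (X - Y) ≤ ε) :
    traceNorm (X - Λ X) ≤ 2 * ε := by
  obtain ⟨P, N, hP, hN, he, ht⟩ := exists_eq_sub_of_isHermitian (hX.sub hY)
  have h1 : X + N = P + Y := by rwa [sub_eq_sub_iff_add_eq_add] at he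
  have h2 := congrArg Λ h1
  rw [hadd, hadd, hfix] at h2
  have h3 : X - Λ X = (P + Λ N) - (N + Λ P) := by
    rw [eq_sub_of_add_eq h2, eq_sub_of_add_eq h1]; abel
  rw [h3]
  refine (traceNorm_sub_le (hP.add (hpos N hN)) (hN.add (hpos P hP))).trans ?_
  rw [trace_add, trace_add, htr, htr, Complex.add_re, Complex.add_re]
  linarith

theorem Decomposable.recoverableFromBC {X : Matrix (A × B × C) (A × B × C) ℂ} {ε : ℝ}
    (hX : IsState X) (h : Decomposable ε X) : RecoverableFromBC (2 * ε) X := by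
  obtain ⟨Υ, hΥ, hε⟩ := h
  obtain ⟨Φ, hΦ, hfix⟩ := hΥ.recoverable.1
  refine ⟨Φ, hΦ, traceNorm_sub_map_le (Λ := fun X => (tensorId C Φ (marginalBC X)).submatrix
    (Equiv.prodAssoc A B C).symm (Equiv.prodAssoc A B C).symm) (fun X Y => ?_)
    (fun X hX => (hΦ.posSemidef_tensorId hX.marginalBC).submatrix _)
    (fun X => ?_) hX.1.isHermitian hΥ.1.1.isHermitian hfix hε⟩
  · rw [marginalBC_add]
    ext p p'
    exact congrFun (congrFun (map_add Φ _ _) _) _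
  · rw [trace_submatrix, hΦ.trace_tensorId, trace_marginalBC]

theorem Decomposable.recoverableFromAB {X : Matrix (A × B × C) (A × B × C) ℂ} {ε : ℝ}
    (hX : IsState X) (h : Decomposable ε X) : RecoverableFromAB (2 * ε) X := by
  obtain ⟨Υ, hΥ, hε⟩ := h
  obtain ⟨Φ, hΦ, hfix⟩ := hΥ.recoverable.2
  refine ⟨Φ, hΦ, traceNorm_sub_map_le (Λ := fun X => idTensor A Φ (marginalAB X)) (fun X Y => ?_)
    (fun X hX => hΦ.posSemidef_idTensor hX.marginalAB)
    (fun X => ?_) hX.1.isHermitian hΥ.1.1.isHermitian hfix hε⟩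
  · rw [marginalAB_add]
    ext p p'
    exact congrFun (congrFun (map_add Φ _ _) _) _
  · rw [hΦ.trace_idTensor, trace_marginalAB]

theorem MarkovianizedDec.markovianizedRecBC {ρ : Matrix (A × B × C) (A × B × C) ℂ}
    (hρ : IsState ρ) {R : ℝ} (h : MarkovianizedDec ρ R) : MarkovianizedRecBC ρ R := by
  intro ε hε
  obtain ⟨N, hN⟩ := h (ε / 2) (half_pos hε)
  refine ⟨N, fun n hn => ?_⟩
  obtain ⟨hK, V, hV⟩ := hN n hn
  have := hV.recoverableFromBC (isState_randomUnitary hK V (isState_tensorPower hρ n))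
  rw [mul_div_cancel₀ _ two_ne_zero] at this
  exact ⟨hK, V, this⟩

theorem MarkovianizedDec.markovianizedRecAB {ρ : Matrix (A × B × C) (A × B × C) ℂ}
    (hρ : IsState ρ) {R : ℝ} (h : MarkovianizedDec ρ R) : MarkovianizedRecAB ρ R := by
  intro ε hε
  obtain ⟨N, hN⟩ := h (ε / 2) (half_pos hε)
  refine ⟨N, fun n hn => ?_⟩
  obtain ⟨hK, V, hV⟩ := hN n hn
  have := hV.recoverableFromAB (isState_randomUnitary hK V (isState_tensorPower hρ n))
  rw [mul_div_cancel₀ _ two_ne_zero] at this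
  exact ⟨hK, V, this⟩

end Decomposable

end Markovianization

theorem mainTheorem2 {A B C : Type*} [Fintype A] [Fintype B] [Fintype C]
    [DecidableEq A] [DecidableEq B] [DecidableEq C]
    (ρ : Matrix (A × B × C) (A × B × C) ℂ) (hρ : Markovianization.IsState ρ) :
    ((Markovianization.condMutualInfo ρ : EReal) ≤ Markovianization.costRecBC ρ ∧
      Markovianization.costRecBC ρ ≤ Markovianization.costDec ρ) ∧
    ((Markovianization.condMutualInfo ρ : EReal) ≤ Markovianization.costRecAB ρ ∧
      Markovianization.costRecAB ρ ≤ Markovianization.costDec ρ) := by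
  refine ⟨⟨le_sInf ?_, sInf_le_sInf (Set.image_mono fun R hR => hR.markovianizedRecBC hρ)⟩,
    le_sInf ?_, sInf_le_sInf (Set.image_mono fun R hR => hR.markovianizedRecAB hρ)⟩
  · rintro _ ⟨R, hR, rfl⟩
    exact EReal.coe_le_coe_iff.mpr
      (Markovianization.condMutualInfo_le_of_markovianizedRecBC hρ hR)
  · rintro _ ⟨R, hR, rfl⟩
    exact EReal.coe_le_coe_iff.mpr
      (Markovianization.condMutualInfo_le_of_markovianizedRecAB hρ hR)
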